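/- Let $K$ be an abstract simplicial complex on $[m]=\{1,\dots,m\}$ (so $\emptyset\in K$ and $K$ is closed under passing to subsets), and let $$(D^1,S^0)^K=\{x\in[-1,1]^m : \{i : x_i\neq\pm1\}\in K\}$$ be its real moment-angle complex. Let $K'$ be the derived complex of $K$: its $k$-simplices are the chains $\sigma_0\subsetneq\sigma_1\subsetneq\cdots\subsetneq\sigma_k$ of nonempty simplices of $K$. Let $K'_+$ be the cone over $K'$ obtained by allowing also $\sigma_0=\emptyset$. For $\sigma\in K$ let $\varphi(\sigma)\in\mathbb{R}^m$ be the point whose $i$-th coordinate is $0$ if $i\in\sigma$ and $1$ otherwise, and let $\mathbb{Z}_2^m$ act on $\mathbb{R}^m$ by changing signs of coordinates. The triangulation $u_{\varphi'}$ of $(D^1,S^0)^K$ is the simplicial complex in $\mathbb{R}^m$ whose simplices are the linear simplices spanned by $g\varphi(\sigma_0),\dots,g\varphi(\sigma_k)$, for $g\in\mathbb{Z}_2^m$ and $(\sigma_0,\dots,\sigma_k)$ a simplex of $K'_+$. **Proposition.** Let $v$ be a vertex of $u_{\varphi'}$ and let $\sigma=\{i : v_i=0\}$, a simplex of $K$.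 * If $\sigma=\emptyset$, the link of $v$ in $u_{\varphi'}$ is $|K'|$, i.e. it is isomorphic to $K'$ as a simplicial complex. * If $\sigma$ is a $k$-simplex of $K$ with $k\ge 0$, then $k$-simplices $\sigma'=(\sigma_0,\dots,\sigma_k)$ of $K'$ with $\sigma_k=\sigma$ exist, and for every such $\sigma'$ the link of $v$ in $u_{\varphi'}$ is PL homeomorphic to the join $$\underbrace{S^0*S^0*\cdots*S^0}_{k+1}*|\mathrm{Lk}(\sigma',K')|,$$ where $\mathrm{Lk}(\sigma',K')$ is the link of $\sigma'$ in $K'$. Here a PL homeomorphism between compact polyhedra is a homeomorphism that is simplicial for suitable finite triangulations of both, and the join with the empty set is $X*\emptyset=X$. -/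

import Mathlib

open Set

noncomputable section

open scoped Classical in
/-- The polyhedral product of the pairs `(X i, A i)` over an abstract simplicial complex `K` on
`Fin m`: the points `x` of the product of the `X i` such that `{i | x i ∈ X i \ A i}` is a simplex
of `K`. The empty simplex belongs to every complex (Mathlib's `K.faces` lists only the
nonempty simplices). -/
def polyhedralProduct {m : ℕ} {α : Type*} (K : PreAbstractSimplicialComplex (Fin m))
    (X A : Fin m → Set α) : Set (Fin m → α) :=
  {x | (∀ i, x i ∈ X i) ∧
    ((Finset.univ.filter fun i => x i ∈ X i \ A i) = ∅ ∨
      (Finset.univ.filter fun i => x i ∈ X i \ A i) ∈ K.faces)}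

/-- The real moment-angle complex `(D¹, S⁰)^K`, with `D¹ = [-1, 1]` and `S⁰ = {-1, 1}`. -/
def realMomentAngleComplex {m : ℕ} (K : PreAbstractSimplicialComplex (Fin m)) :
    Set (Fin m → ℝ) :=
  polyhedralProduct K (fun _ => Icc (-1) 1) (fun _ => {-1, 1})

/-- The derived complex `K'`: its simplices are the nonempty chains of nonempty simplices
of `K`. -/
def derivedComplex {m : ℕ} (K : PreAbstractSimplicialComplex (Fin m)) :
    PreAbstractSimplicialComplex (Finset (Fin m)) where
  faces := {c | c.Nonempty ∧ IsChain (· ⊆ ·) (c : Set (Finset (Fin m))) ∧ ∀ σ ∈ c, σ ∈ K.faces}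
  isRelLowerSet_faces := by
    intro c hc
    refine ⟨hc.1, fun d hd hn => ⟨hn, ?_, fun σ hσ => hc.2.2 σ (hd hσ)⟩⟩
    exact IsChain.mono (Finset.coe_subset.2 hd) hc.2.1

/-- The augmentation `K'₊` of the derived complex: its simplices are the nonempty chains of
possibly empty simplices of `K`. It is the cone over `K'` with apex `∅`. -/
def augmentedDerivedComplex {m : ℕ} (K : PreAbstractSimplicialComplex (Fin m)) :
    PreAbstractSimplicialComplex (Finset (Fin m)) where
  faces := {c | c.Nonempty ∧ IsChain (· ⊆ ·) (c : Set (Finset (Fin m))) ∧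
    ∀ σ ∈ c, σ = ∅ ∨ σ ∈ K.faces}
  isRelLowerSet_faces := by
    intro c hc
    refine ⟨hc.1, fun d hd hn => ⟨hn, ?_, fun σ hσ => hc.2.2 σ (hd hσ)⟩⟩
    exact IsChain.mono (Finset.coe_subset.2 hd) hc.2.1

/-- The vertex `φ(σ)` of the cube: its `i`-th coordinate is `0` if `i ∈ σ` and `1` otherwise. -/
def cubePoint {m : ℕ} (σ : Finset (Fin m)) : Fin m → ℝ := fun i => if i ∈ σ then 0 else 1

/-- The action of `ℤ₂^m` on `ℝ^m` by changing the signs of coordinates. -/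
def signAct {m : ℕ} (g : Fin m → ℤˣ) (x : Fin m → ℝ) : Fin m → ℝ :=
  fun i => (((g i : ℤˣ) : ℤ) : ℝ) * x i

/-- A triangulation of a subset `X` of a real vector space: a geometric simplicial complex whose
underlying space is `X`. -/
structure Triangulation {E : Type*} [AddCommGroup E] [Module ℝ E] (X : Set E) extends
    Geometry.SimplicialComplex ℝ E where
  space_eq : toSimplicialComplex.space = X

section Helpers

variable {m : ℕ}

/-- The sum of the weights of the members of `c` that contain `i`. -/
def layerSum (c : Finset (Finset (Fin m))) (w : Finset (Fin m) → ℝ) (i : Fin m) : ℝ :=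
  ∑ σ ∈ c.filter (fun σ => i ∈ σ), w σ

theorem abs_sign_cast (u : ℤˣ) : |((u : ℤ) : ℝ)| = 1 := by
  rcases Int.units_eq_one_or u with h | h <;> simp [h]

theorem abs_combination (c : Finset (Finset (Fin m))) (w : Finset (Fin m) → ℝ)
    (h1 : ∑ σ ∈ c, w σ = 1) (g : Fin m → ℤˣ) (i : Fin m) :
    (∑ σ ∈ c, w σ • signAct g (cubePoint σ)) i
      = (((g i : ℤˣ) : ℤ) : ℝ) * (1 - layerSum c w i) := by
  have : (1 : ℝ) - layerSum c w i = ∑ σ ∈ c, w σ * cubePoint σ i := by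
    rw [← h1, layerSum, Finset.sum_filter, ← Finset.sum_sub_distrib]
    refine Finset.sum_congr rfl fun σ _ => ?_
    by_cases h : i ∈ σ <;> simp [cubePoint, h]
  rw [this, Finset.sum_apply, Finset.mul_sum]
  refine Finset.sum_congr rfl fun σ _ => ?_
  simp only [Pi.smul_apply, signAct, smul_eq_mul]
  ring

theorem layerSum_le (c : Finset (Finset (Fin m))) (w : Finset (Fin m) → ℝ)
    (h0 : ∀ σ ∈ c, 0 ≤ w σ) (h1 : ∑ σ ∈ c, w σ = 1) (i : Fin m) :
    0 ≤ layerSum c w i ∧ layerSum c w i ≤ 1 := by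
  refine ⟨Finset.sum_nonneg fun σ hσ => h0 σ (Finset.mem_filter.1 hσ).1, ?_⟩
  rw [← h1]
  exact Finset.sum_le_sum_of_subset_of_nonneg (Finset.filter_subset _ _) fun σ hσ _ => h0 σ hσ

/-- Every superlevel set of `layerSum c w` at a height in `(0, 1]` is a member of `c`. -/
theorem exists_superlevel (c : Finset (Finset (Fin m))) (w : Finset (Fin m) → ℝ)
    (hc : IsChain (· ⊆ ·) (c : Set (Finset (Fin m)))) (h0 : ∀ σ ∈ c, 0 ≤ w σ)
    (h1 : ∑ σ ∈ c, w σ = 1) (r : ℝ) (hr0 : 0 < r) (hr1 : r ≤ 1) :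
    ∃ τ ∈ c, ∀ i, i ∈ τ ↔ r ≤ layerSum c w i := by
  classical
  have hne : c.Nonempty := by
    by_contra h
    rw [Finset.not_nonempty_iff_eq_empty] at h
    simp [h] at h1
  set d := c.filter fun τ => r ≤ ∑ ρ ∈ c.filter (fun ρ => τ ⊆ ρ), w ρ with hd
  have hdne : d.Nonempty := by
    obtain ⟨μ, hμ⟩ := c.exists_minimal hne
    refine ⟨μ, Finset.mem_filter.2 ⟨hμ.1, ?_⟩⟩
    have : c.filter (fun ρ => μ ⊆ ρ) = c := by
      refine Finset.filter_true_of_mem fun ρ hρ => ?_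
      rcases hc.total hμ.1 hρ with h | h
      · exact h
      · exact hμ.2 hρ h
    rw [this, h1]; exact hr1
  obtain ⟨τ, hτ⟩ := d.exists_maximal hdne
  have hτc : τ ∈ c := (Finset.mem_filter.1 hτ.1).1
  refine ⟨τ, hτc, fun i => ⟨fun hi => ?_, fun hi => ?_⟩⟩
  · refine (Finset.mem_filter.1 hτ.1).2.trans ?_
    refine Finset.sum_le_sum_of_subset_of_nonneg ?_ fun σ hσ _ => h0 σ (Finset.mem_filter.1 hσ).1
    intro ρ hρ
    rw [Finset.mem_filter] at hρ ⊢
    exact ⟨hρ.1, hρ.2 hi⟩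
  · by_contra hiτ
    have hene : (c.filter fun σ => i ∈ σ).Nonempty := by
      by_contra h
      rw [Finset.not_nonempty_iff_eq_empty] at h
      rw [layerSum, h, Finset.sum_empty] at hi
      linarith
    obtain ⟨ρ, hρ⟩ := (c.filter fun σ => i ∈ σ).exists_minimal hene
    have hρc := Finset.mem_filter.1 hρ.1
    have hρd : ρ ∈ d := by
      refine Finset.mem_filter.2 ⟨hρc.1, hi.trans ?_⟩
      refine Finset.sum_le_sum_of_subset_of_nonneg ?_
        fun σ hσ _ => h0 σ (Finset.mem_filter.1 hσ).1
      intro σ hσ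
      have hσ' := Finset.mem_filter.1 hσ
      refine Finset.mem_filter.2 ⟨hσ'.1, ?_⟩
      rcases hc.total hρc.1 hσ'.1 with h | h
      · exact h
      · exact hρ.2 hσ h
    rcases hc.total hτc hρc.1 with h | h
    · exact hiτ (hτ.2 hρd h hρc.2)
    · exact hiτ (h hρc.2)

/-- A member of `c` of positive weight is a superlevel set of `layerSum c w`. -/
theorem eq_superlevel (c : Finset (Finset (Fin m))) (w : Finset (Fin m) → ℝ)
    (hc : IsChain (· ⊆ ·) (c : Set (Finset (Fin m)))) (h0 : ∀ σ ∈ c, 0 ≤ w σ)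
    (h1 : ∑ σ ∈ c, w σ = 1) (σ : Finset (Fin m)) (hσ : σ ∈ c) (hw : 0 < w σ) :
    ∃ r : ℝ, 0 < r ∧ r ≤ 1 ∧ ∀ i, i ∈ σ ↔ r ≤ layerSum c w i := by
  classical
  have hmem : σ ∈ c.filter (fun ρ => σ ⊆ ρ) := Finset.mem_filter.2 ⟨hσ, subset_rfl⟩
  have hn : ∀ τ ∈ c.filter (fun ρ => σ ⊆ ρ), 0 ≤ w τ :=
    fun τ hτ => h0 τ (Finset.mem_filter.1 hτ).1
  refine ⟨∑ ρ ∈ c.filter (fun ρ => σ ⊆ ρ), w ρ,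
    hw.trans_le (Finset.single_le_sum hn hmem), ?_, fun i => ⟨fun hi => ?_, fun hi => ?_⟩⟩
  · rw [← h1]
    exact Finset.sum_le_sum_of_subset_of_nonneg (Finset.filter_subset _ _) fun σ hσ _ => h0 σ hσ
  · refine Finset.sum_le_sum_of_subset_of_nonneg ?_ fun σ hσ _ => h0 σ (Finset.mem_filter.1 hσ).1
    intro ρ hρ
    rw [Finset.mem_filter] at hρ ⊢
    exact ⟨hρ.1, hρ.2 hi⟩
  · by_contra hiσ
    rw [← Finset.add_sum_erase _ _ hmem] at hi
    have : layerSum c w i ≤ ∑ x ∈ (c.filter (fun ρ => σ ⊆ ρ)).erase σ, w x := by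
      refine Finset.sum_le_sum_of_subset_of_nonneg ?_
        fun τ hτ _ => hn τ (Finset.mem_of_mem_erase hτ)
      intro ρ hρ
      have hρ' := Finset.mem_filter.1 hρ
      refine Finset.mem_erase.2 ⟨fun h => hiσ (h ▸ hρ'.2), Finset.mem_filter.2 ⟨hρ'.1, ?_⟩⟩
      rcases hc.total hσ hρ'.1 with h | h
      · exact h
      · exact absurd (h hρ'.2) hiσ
    linarith

theorem signAct_cubePoint_injective (g : Fin m → ℤˣ) :
    Function.Injective fun σ : Finset (Fin m) => signAct g (cubePoint σ) := by
  intro σ τ h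
  ext i
  have hi := congrFun h i
  have hg : (((g i : ℤˣ) : ℤ) : ℝ) ≠ 0 := by
    intro h0
    have := abs_sign_cast (g i)
    rw [h0] at this
    simp at this
  simp only [signAct, cubePoint] at hi
  by_cases h1 : i ∈ σ <;> by_cases h2 : i ∈ τ <;> simp_all

theorem mem_convexHull_image_iff {V E : Type*} [AddCommGroup E] [Module ℝ E] [DecidableEq E]
    {f : V → E} (hf : Function.Injective f) (c : Finset V) (x : E) :
    x ∈ convexHull ℝ ((c.image f : Finset E) : Set E) ↔
      ∃ w : V → ℝ, (∀ a ∈ c, 0 ≤ w a) ∧ ∑ a ∈ c, w a = 1 ∧ ∑ a ∈ c, w a • f a = x := by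
  rw [Finset.mem_convexHull']
  constructor
  · rintro ⟨w, h0, h1, rfl⟩
    refine ⟨w ∘ f, fun a ha => h0 _ (Finset.mem_image_of_mem f ha), ?_, ?_⟩
    · rw [← h1, Finset.sum_image hf.injOn]; rfl
    · rw [Finset.sum_image hf.injOn]; rfl
  · rintro ⟨w, h0, h1, rfl⟩
    have hz : ∀ a ∈ c, Function.extend f w 0 (f a) = w a := fun a _ => hf.extend_apply w 0 a
    refine ⟨Function.extend f w 0, ?_, ?_, ?_⟩
    · intro y hy
      obtain ⟨a, ha, rfl⟩ := Finset.mem_image.1 hy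
      rw [hz a ha]; exact h0 a ha
    · rw [Finset.sum_image hf.injOn, ← h1]
      exact Finset.sum_congr rfl hz
    · rw [Finset.sum_image hf.injOn]
      exact Finset.sum_congr rfl fun a ha => by rw [hz a ha]

/-- The linear simplices spanned by two signed chains meet in a common face. -/
theorem signed_simplices_inter [DecidableEq (Fin m → ℝ)] (c d : Finset (Finset (Fin m)))
    (hc : IsChain (· ⊆ ·) (c : Set (Finset (Fin m))))
    (hd : IsChain (· ⊆ ·) (d : Set (Finset (Fin m)))) (g h : Fin m → ℤˣ) :
    convexHull ℝ ((c.image fun σ => signAct g (cubePoint σ) : Finset (Fin m → ℝ)) :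
        Set (Fin m → ℝ)) ∩
      convexHull ℝ ((d.image fun σ => signAct h (cubePoint σ) : Finset (Fin m → ℝ)) :
        Set (Fin m → ℝ)) ⊆
      convexHull ℝ (((c.image fun σ => signAct g (cubePoint σ) : Finset (Fin m → ℝ)) :
        Set (Fin m → ℝ)) ∩
        ((d.image fun σ => signAct h (cubePoint σ) : Finset (Fin m → ℝ)) :
        Set (Fin m → ℝ))) := by
  rintro x ⟨hx, hx'⟩
  rw [mem_convexHull_image_iff (signAct_cubePoint_injective g)] at hx
  rw [mem_convexHull_image_iff (signAct_cubePoint_injective h)] at hx'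
  obtain ⟨w, w0, w1, hw⟩ := hx
  obtain ⟨w', w0', w1', hw'⟩ := hx'
  have e1 : ∀ i, x i = (((g i : ℤˣ) : ℤ) : ℝ) * (1 - layerSum c w i) := fun i => by
    rw [← hw]; exact abs_combination c w w1 g i
  have e2 : ∀ i, x i = (((h i : ℤˣ) : ℤ) : ℝ) * (1 - layerSum d w' i) := fun i => by
    rw [← hw']; exact abs_combination d w' w1' h i
  have a1 : ∀ i, |x i| = 1 - layerSum c w i := fun i => by
    rw [e1, abs_mul, abs_sign_cast, one_mul, abs_of_nonneg]
    linarith [(layerSum_le c w w0 w1 i).2]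
  have a2 : ∀ i, |x i| = 1 - layerSum d w' i := fun i => by
    rw [e2, abs_mul, abs_sign_cast, one_mul, abs_of_nonneg]
    linarith [(layerSum_le d w' w0' w1' i).2]
  have key : ∀ σ ∈ c, w σ ≠ 0 → signAct g (cubePoint σ) ∈
      (((c.image fun σ => signAct g (cubePoint σ) : Finset (Fin m → ℝ)) : Set (Fin m → ℝ)) ∩
        ((d.image fun σ => signAct h (cubePoint σ) : Finset (Fin m → ℝ)) :
        Set (Fin m → ℝ))) := by
    intro σ hσ hne
    have hpos : 0 < w σ := lt_of_le_of_ne (w0 σ hσ) hne.symm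
    refine ⟨Finset.mem_coe.2 (Finset.mem_image.2 ⟨σ, hσ, rfl⟩), ?_⟩
    obtain ⟨r, r0, r1, hr⟩ := eq_superlevel c w hc w0 w1 σ hσ hpos
    obtain ⟨τ, hτ, hτr⟩ := exists_superlevel d w' hd w0' w1' r r0 r1
    have hστ : τ = σ := by
      ext i
      have := a1 i
      have := a2 i
      rw [hr, hτr, show layerSum d w' i = layerSum c w i by linarith]
    subst hστ
    refine Finset.mem_coe.2 (Finset.mem_image.2 ⟨τ, hτ, ?_⟩)
    ext i
    simp only [signAct, cubePoint]
    by_cases hi : i ∈ τ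
    · simp [hi]
    · have hlt : layerSum c w i < 1 := by
        rcases lt_or_eq_of_le (layerSum_le c w w0 w1 i).2 with hl | hl
        · exact hl
        · exact absurd ((hr i).2 (by rw [hl]; exact r1)) hi
      have h12 : layerSum d w' i = layerSum c w i := by linarith [a1 i, a2 i]
      have h3 := (e1 i).symm.trans (e2 i)
      rw [h12] at h3
      rw [mul_right_cancel₀ (by linarith : (1 : ℝ) - layerSum c w i ≠ 0) h3]
  rw [← hw, ← Finset.sum_filter_of_ne (p := fun σ => w σ ≠ 0)
    (fun σ _ hne h0 => hne (by rw [h0, zero_smul]))]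
  refine (convex_convexHull ℝ _).sum_mem (fun σ hσ => w0 σ (Finset.mem_filter.1 hσ).1) ?_
    (fun σ hσ => subset_convexHull ℝ _ (key σ (Finset.mem_filter.1 hσ).1
      (Finset.mem_filter.1 hσ).2))
  rw [Finset.sum_filter_ne_zero, w1]

theorem signed_simplex_indep [DecidableEq (Fin m → ℝ)] (c : Finset (Finset (Fin m)))
    (hc : IsChain (· ⊆ ·) (c : Set (Finset (Fin m)))) (g : Fin m → ℤˣ) :
    AffineIndependent ℝ ((↑) : (c.image fun σ => signAct g (cubePoint σ)) → (Fin m → ℝ)) := by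
  classical
  set f : Finset (Fin m) → (Fin m → ℝ) := fun σ => signAct g (cubePoint σ) with hf
  have hinj : Function.Injective f := signAct_cubePoint_injective g
  have hfc : AffineIndependent ℝ (fun σ : c => f σ) := by
    by_contra hdep
    obtain ⟨I, x, hx1, hx2⟩ := Convex.radon_partition hdep
    have hI : ∀ J : Set c, ∃ d : Finset (Finset (Fin m)), d ⊆ c ∧
        (fun σ : c => f σ) '' J = ((d.image f : Finset (Fin m → ℝ)) : Set (Fin m → ℝ)) ∧
        ∀ σ : c, (σ : Finset (Fin m)) ∈ d ↔ σ ∈ J := by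
      intro J
      refine ⟨(Finset.univ.filter (· ∈ J)).image Subtype.val, ?_, ?_, ?_⟩
      · intro σ hσ
        obtain ⟨τ, _, rfl⟩ := Finset.mem_image.1 hσ
        exact τ.2
      · ext y
        simp
      · intro σ
        simp
    obtain ⟨d, hdc, hd, hdJ⟩ := hI I
    obtain ⟨d', hdc', hd', hdJ'⟩ := hI Iᶜ
    have hmem := signed_simplices_inter d d' (hc.mono (Finset.coe_subset.2 hdc))
      (hc.mono (Finset.coe_subset.2 hdc')) g g ⟨by rw [hd] at hx1; exact hx1,
        by rw [hd'] at hx2; exact hx2⟩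
    obtain ⟨y, hy, hy'⟩ := convexHull_nonempty_iff.1 ⟨x, hmem⟩
    obtain ⟨σ, hσ, rfl⟩ := Finset.mem_image.1 (Finset.mem_coe.1 hy)
    obtain ⟨τ, hτ, hστ⟩ := Finset.mem_image.1 (Finset.mem_coe.1 hy')
    obtain rfl := hinj hστ
    exact (hdJ' ⟨τ, hdc hσ⟩).1 hτ ((hdJ ⟨τ, hdc hσ⟩).1 hσ)
  have := hfc.range
  refine this.mono ?_
  intro y hy
  obtain ⟨σ, hσ, rfl⟩ := Finset.mem_image.1 (Finset.mem_coe.1 hy)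
  exact ⟨⟨σ, hσ⟩, rfl⟩

/-- A function with values in `[0, B]` is a nonnegative combination, of total weight `B`, of
indicators of a chain of subsets of its support. -/
theorem exists_layers (n : ℕ) : ∀ (S : Finset (Fin m)) (y : Fin m → ℝ) (B : ℝ), S.card = n →
    (∀ i, i ∈ S ↔ 0 < y i) → (∀ i, 0 ≤ y i ∧ y i ≤ B) → 0 ≤ B →
    ∃ (c : Finset (Finset (Fin m))) (w : Finset (Fin m) → ℝ), c.Nonempty ∧
      IsChain (· ⊆ ·) (c : Set (Finset (Fin m))) ∧ (∀ σ ∈ c, σ ⊆ S) ∧ (∀ σ ∈ c, 0 ≤ w σ) ∧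
      ∑ σ ∈ c, w σ = B ∧ ∀ i, layerSum c w i = y i := by
  classical
  induction n using Nat.strong_induction_on with
  | _ n ih =>
    intro S y B hn hS hy hB
    rcases S.eq_empty_or_nonempty with rfl | hne
    · refine ⟨{∅}, fun _ => B, by simp, by simp, by simp, by simpa using hB, by simp, ?_⟩
      intro i
      have hi := hS i
      simp only [Finset.notMem_empty, false_iff, not_lt] at hi
      rw [le_antisymm hi (hy i).1, layerSum, Finset.filter_singleton]
      simp
    · obtain ⟨j, hj, hmin⟩ := S.exists_min_image y hne
      have hyj := (hS j).1 hj
      let y' : Fin m → ℝ := fun i => if i ∈ S then y i - y j else 0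
      let S' := S.filter fun i => y j < y i
      have hS'S : S' ⊂ S := by
        refine Finset.filter_ssubset.2 ⟨j, hj, lt_irrefl _⟩
      obtain ⟨c, w, hcne, hc, hcS, w0, w1, hl⟩ := ih S'.card (hn ▸ Finset.card_lt_card hS'S) S' y'
        (B - y j) rfl
        (by
          intro i
          simp only [S', y', Finset.mem_filter]
          by_cases h : i ∈ S <;> simp [h])
        (by
          intro i
          have := hy i
          have := hy j
          simp only [y']
          by_cases h : i ∈ S
          · have := hmin i h
            simp only [h, if_true]
            constructor <;> linarith
          · simp only [h, if_false]
            constructor <;> linarith)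
        (by linarith [hy j])
      have hSc : S ∉ c := fun h => hS'S.2 (hcS S h)
      have hw : ∀ σ ∈ c, Function.update w S (y j) σ = w σ := fun σ hσ =>
        Function.update_of_ne (fun h => hSc (by rw [← h]; exact hσ)) _ _
      refine ⟨insert S c, Function.update w S (y j), Finset.insert_nonempty _ _, ?_, ?_, ?_, ?_, ?_⟩
      · rw [Finset.coe_insert]
        exact hc.insert fun σ hσ _ => Or.inr ((hcS σ hσ).trans hS'S.1)
      · intro σ hσ
        rcases Finset.mem_insert.1 hσ with rfl | h
        · exact subset_rfl
        · exact (hcS σ h).trans hS'S.1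
      · intro σ hσ
        rcases Finset.mem_insert.1 hσ with rfl | h
        · simpa using hyj.le
        · rw [hw σ h]; exact w0 σ h
      · rw [Finset.sum_insert hSc, Finset.sum_congr rfl hw, w1]
        simp
      · intro i
        have hfil : ∑ σ ∈ c.filter (fun σ => i ∈ σ), Function.update w S (y j) σ = y' i := by
          rw [← hl i]
          exact Finset.sum_congr rfl fun σ hσ => hw σ (Finset.mem_filter.1 hσ).1
        rw [layerSum, Finset.filter_insert]
        by_cases h : i ∈ S
        · rw [if_pos h, Finset.sum_insert (fun h' => hSc (Finset.mem_filter.1 h').1), hfil]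
          simp [y', h]
        · rw [if_neg h, hfil]
          have h' := (hS i).not.1 h
          simp only [y', h, if_false]
          exact le_antisymm (hy i).1 (not_lt.1 h')

end Helpers

open scoped Classical in
/-- The simplicial complex in `ℝ^m` whose simplices are the linear simplices spanned by the points
`g φ(σ₀), …, g φ(σ_k)`, for `g ∈ ℤ₂^m` and `(σ₀, …, σ_k)` a simplex of `K'₊`. -/
def signedComplex {m : ℕ} (K : PreAbstractSimplicialComplex (Fin m)) :
    Geometry.SimplicialComplex ℝ (Fin m → ℝ) where
  faces := ⋃ g : Fin m → ℤˣ,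
    ((augmentedDerivedComplex K).map fun σ => signAct g (cubePoint σ)).faces
  isRelLowerSet_faces := IsRelLowerSet.iUnion fun g =>
    ((augmentedDerivedComplex K).map fun σ => signAct g (cubePoint σ)).isRelLowerSet_faces
  indep := by
    intro s hs
    obtain ⟨g, c, hc, rfl⟩ := mem_iUnion.1 hs
    exact signed_simplex_indep c hc.2.1 g
  inter_subset_convexHull := by
    intro s t hs ht
    obtain ⟨g, c, hc, rfl⟩ := mem_iUnion.1 hs
    obtain ⟨h, d, hd, rfl⟩ := mem_iUnion.1 ht
    exact signed_simplices_inter c d hc.2.1 hd.2.1 g h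

theorem mem_realMomentAngleComplex_iff {m : ℕ} (K : PreAbstractSimplicialComplex (Fin m))
    (x : Fin m → ℝ) : x ∈ realMomentAngleComplex K ↔ (∀ i, |x i| ≤ 1) ∧
      ∃ S : Finset (Fin m), (S = ∅ ∨ S ∈ K.faces) ∧ ∀ i, i ∈ S ↔ 0 < 1 - |x i| := by
  classical
  have h2 : ∀ i, |x i| ≤ 1 → (x i ∈ Icc (-1 : ℝ) 1 \ {-1, 1} ↔ 0 < 1 - |x i|) := by
    intro i hi
    rw [mem_sdiff, mem_Icc, mem_insert_iff, mem_singleton_iff]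
    rw [abs_le] at hi
    rw [sub_pos, abs_lt]
    constructor
    · rintro ⟨_, hn⟩
      push Not at hn
      exact ⟨lt_of_le_of_ne hi.1 hn.1.symm, lt_of_le_of_ne hi.2 hn.2⟩
    · rintro ⟨ha, hb⟩
      exact ⟨hi, by rintro (h | h) <;> linarith⟩
  simp only [realMomentAngleComplex, polyhedralProduct, mem_ofPred_eq, mem_Icc, ← abs_le]
  refine and_congr_right fun hx => ⟨fun h => ⟨_, h, fun i => ?_⟩, ?_⟩
  · rw [← h2 i (hx i)]
    simp only [Finset.mem_filter, Finset.mem_univ, true_and]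
  · rintro ⟨S, hS, hiS⟩
    have : S = Finset.univ.filter (fun i => x i ∈ Icc (-1 : ℝ) 1 \ {-1, 1}) := by
      ext i
      rw [hiS, ← h2 i (hx i)]
      simp only [Finset.mem_filter, Finset.mem_univ, true_and]
    rw [this] at hS
    convert hS using 2

/-- The triangulation `u_{φ'}` of the real moment-angle complex `(D¹, S⁰)^K`: its simplices are the
images under `[g, x] ↦ g φ'(x)` of the simplices `[g, |(σ₀, …, σ_k)|]` of the basic construction
`𝒰(ℤ₂^m, |K'₊|)`, where `φ'` is the map linear on each simplex of `K'₊` that extends `φ`. -/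
def momentAngleTriangulation {m : ℕ} (K : PreAbstractSimplicialComplex (Fin m)) :
    Triangulation (realMomentAngleComplex K) where
  toSimplicialComplex := signedComplex K
  space_eq := by
    classical
    ext x
    rw [Geometry.SimplicialComplex.mem_space_iff, mem_realMomentAngleComplex_iff]
    constructor
    · rintro ⟨s, hs, hx⟩
      obtain ⟨g, c, hc, rfl⟩ := mem_iUnion.1 hs
      have hx' := (mem_convexHull_image_iff (signAct_cubePoint_injective g) c x).1
        (by convert hx using 3)
      obtain ⟨w, w0, w1, rfl⟩ := hx'
      have ha : ∀ i, |(∑ σ ∈ c, w σ • signAct g (cubePoint σ)) i| = 1 - layerSum c w i := by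
        intro i
        rw [abs_combination c w w1, abs_mul, abs_sign_cast, one_mul, abs_of_nonneg]
        linarith [(layerSum_le c w w0 w1 i).2]
      refine ⟨fun i => by rw [ha]; linarith [(layerSum_le c w w0 w1 i).1],
        Finset.univ.filter fun i => 0 < layerSum c w i, ?_, fun i => by
          rw [ha, Finset.mem_filter]; simp⟩
      obtain ⟨μ, hμ⟩ := c.exists_maximal hc.1
      have hsub : (Finset.univ.filter fun i => 0 < layerSum c w i) ⊆ μ := by
        intro i hi
        rw [Finset.mem_filter] at hi
        obtain ⟨σ, hσ, _⟩ := Finset.exists_ne_zero_of_sum_ne_zero hi.2.ne'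
        rw [Finset.mem_filter] at hσ
        rcases hc.2.1.total hσ.1 hμ.1 with h | h
        · exact h hσ.2
        · exact hμ.2 hσ.1 h hσ.2
      rcases Finset.eq_empty_or_nonempty
        (Finset.univ.filter fun i => 0 < layerSum c w i) with h | h
      · exact Or.inl h
      · refine Or.inr ?_
        rcases hc.2.2 μ hμ.1 with h0 | hK
        · rw [h0, Finset.subset_empty] at hsub
          rw [hsub] at h
          simp at h
        · exact (K.isRelLowerSet_faces hK).2 hsub h
    · rintro ⟨hx, S, hSK, hS⟩
      obtain ⟨c, w, hcne, hc, hcS, w0, w1, hl⟩ := exists_layers S.card S (fun i => 1 - |x i|) 1 rfl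
        hS (fun i => ⟨by linarith [hx i], by linarith [abs_nonneg (x i)]⟩) zero_le_one
      let g : Fin m → ℤˣ := fun i => if 0 ≤ x i then 1 else -1
      refine ⟨c.image fun σ => signAct g (cubePoint σ),
        mem_iUnion.2 ⟨g, c, ⟨hcne, hc, fun σ hσ => ?_⟩, ?_⟩, ?_⟩
      · rcases σ.eq_empty_or_nonempty with h | h
        · exact Or.inl h
        · rcases hSK with h0 | hK
          · have := hcS σ hσ
            rw [h0, Finset.subset_empty] at this
            exact Or.inl this
          · exact Or.inr ((K.isRelLowerSet_faces hK).2 (hcS σ hσ) h)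
      · ext; simp
      · rw [mem_convexHull_image_iff (signAct_cubePoint_injective g)]
        refine ⟨w, w0, w1, ?_⟩
        ext i
        rw [abs_combination c w w1, hl]
        by_cases h : 0 ≤ x i
        · simp [g, h, abs_of_nonneg h]
        · simp [g, h, abs_of_neg (not_le.1 h)]

/-- The vertices of an abstract simplicial complex. -/
def PreAbstractSimplicialComplex.vertexSet {V : Type*} (A : PreAbstractSimplicialComplex V) :
    Set V :=
  {v | {v} ∈ A.faces}

open scoped Classical in
/-- The link of a simplex `s` in an abstract simplicial complex. -/
def PreAbstractSimplicialComplex.simplexLink {V : Type*} (A : PreAbstractSimplicialComplex V)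
    (s : Finset V) : PreAbstractSimplicialComplex V where
  faces := {t | t ∈ A.faces ∧ Disjoint t s ∧ t ∪ s ∈ A.faces}
  isRelLowerSet_faces := fun _ ht => ⟨(A.isRelLowerSet_faces ht.1).1, fun _ hu hn =>
    ⟨(A.isRelLowerSet_faces ht.1).2 hu hn, ht.2.1.mono_left hu,
      (A.isRelLowerSet_faces ht.2.2).2 (Finset.union_subset_union_left hu)
        (hn.mono Finset.subset_union_left)⟩⟩

/-- The geometric realization `|A|` of an abstract simplicial complex on a finite vertex set:
the points with barycentric coordinates supported on a simplex. -/
def PreAbstractSimplicialComplex.realization {V : Type*} [Fintype V]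
    (A : PreAbstractSimplicialComplex V) : Set (V → ℝ) :=
  {x | x ∈ stdSimplex ℝ V ∧ ∃ s ∈ A.faces, ∀ a, a ∈ s ↔ x a ≠ 0}

open scoped Classical in
/-- The link of a vertex `v` in a geometric simplicial complex. -/
def Geometry.SimplicialComplex.vertexLink {E : Type*} [AddCommGroup E] [Module ℝ E]
    (S : Geometry.SimplicialComplex ℝ E) (v : E) : Geometry.SimplicialComplex ℝ E where
  faces := {t | t ∈ S.faces ∧ v ∉ t ∧ insert v t ∈ S.faces}
  isRelLowerSet_faces := fun _ ht => ⟨(S.isRelLowerSet_faces ht.1).1, fun _ hu hn =>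
    ⟨(S.isRelLowerSet_faces ht.1).2 hu hn, fun hv => ht.2.1 (hu hv),
      (S.isRelLowerSet_faces ht.2.2).2 (Finset.insert_subset_insert v hu)
        (Finset.insert_nonempty _ _)⟩⟩
  indep := fun ht => S.indep ht.1
  inter_subset_convexHull := fun hs ht => S.inter_subset_convexHull hs.1 ht.1

open scoped Classical in
/-- Two simplicial complexes are isomorphic: some map, injective on the vertices of `A`, carries
the simplices of `A` exactly onto the simplices of `B`. -/
def SimpliciallyIsomorphic {V W : Type*} (A : PreAbstractSimplicialComplex V)
    (B : PreAbstractSimplicialComplex W) : Prop :=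
  ∃ f : V → W, InjOn f A.vertexSet ∧ A.map f = B

section PL

variable {E F : Type*} [AddCommGroup E] [Module ℝ E] [AddCommGroup F] [Module ℝ F]

open scoped Classical in
/-- `f` is a simplicial map from `S` to `T`: it maps the vertices of each simplex of `S` onto the
vertices of a simplex of `T`, and it is linear in barycentric coordinates on each simplex. -/
def IsSimplicialMap (S : Geometry.SimplicialComplex ℝ E) (T : Geometry.SimplicialComplex ℝ F)
    (f : E → F) : Prop :=
  ∀ s ∈ S.faces, s.image f ∈ T.faces ∧
    ∀ w : E → ℝ, (∀ a ∈ s, 0 ≤ w a) → ∑ a ∈ s, w a = 1 →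
      f (∑ a ∈ s, w a • a) = ∑ a ∈ s, w a • f a

/-- Two compact polyhedra are PL homeomorphic: there is a homeomorphism between them that is
simplicial with respect to suitable (finite) triangulations of both. -/
def PLHomeomorphic [TopologicalSpace E] [TopologicalSpace F] (X : Set E) (Y : Set F) : Prop :=
  ∃ (e : X ≃ₜ Y) (S : Triangulation X) (T : Triangulation Y) (f : E → F),
    S.faces.Finite ∧ T.faces.Finite ∧ (∀ x : X, f x = e x) ∧
      IsSimplicialMap S.toSimplicialComplex T.toSimplicialComplex f

/-- The exterior join of the disjoint sets `X` and `Y` exists: two distinct segments, each joining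
a point of `X` to a point of `Y`, meet in at most one point, and only in a common endpoint. -/
def ExteriorJoinExists (X Y : Set E) : Prop :=
  Disjoint X Y ∧ ∀ x ∈ X, ∀ y ∈ Y, ∀ x' ∈ X, ∀ y' ∈ Y, (x = x' ∧ y = y') ∨
    ((segment ℝ x y ∩ segment ℝ x' y').Subsingleton ∧
      segment ℝ x y ∩ segment ℝ x' y' ⊆ {x, y} ∩ {x', y'})

/-- The join `X * Y`: the union of `X`, `Y` and the segments from points of `X` to points of `Y`.
In particular `X * ∅ = X`. -/
def polyhedralJoin (X Y : Set E) : Set E := X ∪ Y ∪ convexJoin ℝ X Y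

/-- The `i`-th copy of `S⁰`, placed at `±e_i` in `ℝ^n × F`. -/
def zeroSphere {n : ℕ} (F : Type*) [AddCommGroup F] (i : Fin n) : Set ((Fin n → ℝ) × F) :=
  {(Pi.single i 1, 0), (-Pi.single i 1, 0)}

/-- The iterated join `S⁰ * (S⁰ * ⋯ * (S⁰ * L))` with `n` copies of `S⁰`, where the copies of `S⁰`
are placed at `±e_1, …, ±e_n` in `ℝ^n × F` and `L` in `0 × F`. -/
def zeroSpheresJoin (n : ℕ) (L : Set F) : Set ((Fin n → ℝ) × F) :=
  ((List.finRange n).map (zeroSphere F)).foldr polyhedralJoin ((fun y => (0, y)) '' L)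

end PL

section ExteriorJoins

variable {n : ℕ} {V : Type*}

/-- The `ℓ¹` norm on `ℝ^n × ℝ^V`. -/
def taxicab [Fintype V] (p : (Fin n → ℝ) × (V → ℝ)) : ℝ := ∑ j, |p.1 j| + ∑ a, |p.2 a|

theorem mem_zeroSphere_iff (i : Fin n) (x : (Fin n → ℝ) × (V → ℝ)) :
    x ∈ zeroSphere (V → ℝ) i ↔ ∃ ε : ℝ, |ε| = 1 ∧ x = (Pi.single i ε, 0) := by
  simp only [zeroSphere, mem_insert_iff, mem_singleton_iff]
  constructor
  · rintro (rfl | rfl)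
    · exact ⟨1, by simp, rfl⟩
    · exact ⟨-1, by simp, by rw [Pi.single_neg]⟩
  · rintro ⟨ε, hε, rfl⟩
    rcases eq_or_eq_neg_of_abs_eq hε with rfl | rfl
    · exact Or.inl rfl
    · exact Or.inr (by rw [Pi.single_neg])

theorem taxicab_combination [Fintype V] (i : Fin n) (ε a b : ℝ) (hε : |ε| = 1) (ha : 0 ≤ a) (hb : 0 ≤ b)
    (y : (Fin n → ℝ) × (V → ℝ)) (hy : y.1 i = 0) :
    taxicab (a • ((Pi.single i ε, 0) : (Fin n → ℝ) × (V → ℝ)) + b • y) = a + b * taxicab y := by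
  have h1 : ∀ j, |(a • ((Pi.single i ε, 0) : (Fin n → ℝ) × (V → ℝ)) + b • y).1 j|
      = (if j = i then a else 0) + b * |y.1 j| := by
    intro j
    by_cases h : j = i
    · subst h
      simp [hy, abs_mul, hε, abs_of_nonneg ha]
    · simp [h, abs_mul, abs_of_nonneg hb]
  have h2 : ∀ j, |(a • ((Pi.single i ε, 0) : (Fin n → ℝ) × (V → ℝ)) + b • y).2 j|
      = b * |y.2 j| := by
    intro j
    simp [abs_mul, abs_of_nonneg hb]
  simp only [taxicab, h1, h2, Finset.sum_add_distrib, ← Finset.mul_sum]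
  simp
  ring

theorem foldr_join_coords [Fintype V] (L : Set (V → ℝ)) (hL : L ⊆ stdSimplex ℝ V) (l : List (Fin n))
    (hl : l.Nodup) : ∀ p ∈ (l.map (zeroSphere (V → ℝ))).foldr polyhedralJoin
      ((fun y => (0, y)) '' L), (∀ j, j ∉ l → p.1 j = 0) ∧ taxicab p = 1 := by
  induction l with
  | nil =>
    rintro p ⟨y, hy, rfl⟩
    have := hL hy
    refine ⟨fun j _ => rfl, ?_⟩
    simp only [taxicab, Pi.zero_apply, abs_zero, Finset.sum_const_zero, zero_add]
    rw [← this.2]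
    exact Finset.sum_congr rfl fun a _ => abs_of_nonneg (this.1 a)
  | cons i l ih =>
    have ih' := ih (List.nodup_cons.1 hl).2
    have hi := (List.nodup_cons.1 hl).1
    intro p hp
    rw [List.map_cons, List.foldr_cons] at hp
    rcases hp with (hp | hp) | hp
    · obtain ⟨ε, hε, rfl⟩ := (mem_zeroSphere_iff i p).1 hp
      refine ⟨fun j hj => ?_, ?_⟩
      · have : j ≠ i := fun h => hj (by simp [h])
        simp [this]
      · have := taxicab_combination (V := V) i ε 1 0 hε zero_le_one le_rfl 0 rfl
        simpa using this
    · exact ⟨fun j hj => (ih' p hp).1 j fun h => hj (List.mem_cons_of_mem _ h), (ih' p hp).2⟩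
    · obtain ⟨x, hx, y, hy, a, b, ha, hb, hab, rfl⟩ := mem_convexJoin.1 hp
      obtain ⟨ε, hε, rfl⟩ := (mem_zeroSphere_iff i x).1 hx
      obtain ⟨hy0, hy1⟩ := ih' y hy
      refine ⟨fun j hj => ?_, ?_⟩
      · have h1 : j ≠ i := fun h => hj (by simp [h])
        have h2 : y.1 j = 0 := hy0 j fun h => hj (List.mem_cons_of_mem _ h)
        simp [h1, h2]
      · rw [taxicab_combination i ε a b hε ha hb y (hy0 i hi), hy1, mul_one, hab]

/-- All the joins taken in `zeroSpheresJoin` are exterior joins when `L` is a set of points given by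
barycentric coordinates. -/
theorem exteriorJoinExists_zeroSphere [Fintype V] (L : Set (V → ℝ)) (hL : L ⊆ stdSimplex ℝ V) (i : Fin n)
    (l : List (Fin n)) (hil : (i :: l).Nodup) :
    ExteriorJoinExists (zeroSphere (V → ℝ) i)
      ((l.map (zeroSphere (V → ℝ))).foldr polyhedralJoin ((fun y => (0, y)) '' L)) := by
  have hi := (List.nodup_cons.1 hil).1
  have hW := foldr_join_coords L hL l (List.nodup_cons.1 hil).2
  set W := (l.map (zeroSphere (V → ℝ))).foldr polyhedralJoin ((fun y => (0, y)) '' L)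
  constructor
  · rw [Set.disjoint_left]
    intro p hp hpW
    obtain ⟨ε, hε, rfl⟩ := (mem_zeroSphere_iff i p).1 hp
    have := (hW _ hpW).1 i hi
    simp only [Pi.single_eq_same] at this
    simp [this] at hε
  · intro x hx y hy x' hx' y' hy'
    by_cases hne : x = x' ∧ y = y'
    · exact Or.inl hne
    right
    have key : ∀ z ∈ segment ℝ x y ∩ segment ℝ x' y',
        (x = x' ∧ z = x) ∨ (y = y' ∧ z = y) := by
      rintro z ⟨⟨a, b, ha, hb, hab, rfl⟩, ⟨a', b', ha', hb', hab', hz⟩⟩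
      obtain ⟨ε, hε, rfl⟩ := (mem_zeroSphere_iff i x).1 hx
      obtain ⟨ε', hε', rfl⟩ := (mem_zeroSphere_iff i x').1 hx'
      have hy0 := (hW y hy).1 i hi
      have hy0' := (hW y' hy').1 i hi
      have hc : a' * ε' = a * ε := by
        have := congrArg (fun p : (Fin n → ℝ) × (V → ℝ) => p.1 i) hz
        simpa [hy0, hy0'] using this
      have haa : a' = a := by
        have := congrArg abs hc
        rwa [abs_mul, abs_mul, hε, hε', mul_one, mul_one, abs_of_nonneg ha, abs_of_nonneg ha']
          at this
      subst haa
      have hbb : b' = b := by linarith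
      subst hbb
      rcases ha.eq_or_lt with h0 | h0
      · have hb1 : b' = 1 := by linarith
        subst h0 hb1
        right
        simp only [zero_smul, one_smul, zero_add] at hz ⊢
        exact ⟨hz.symm, trivial⟩
      · have hεε : ε' = ε := mul_left_cancel₀ h0.ne' hc
        subst hεε
        rcases hb.eq_or_lt with h1 | h1
        · have ha1 : a' = 1 := by linarith
          subst h1 ha1
          left
          simp
        · exfalso
          refine hne ⟨rfl, ?_⟩
          have := add_left_cancel hz
          exact (smul_right_injective _ h1.ne' this).symm
    constructor
    · intro z hz z' hz'
      rcases key z hz with ⟨h1, h2⟩ | ⟨h1, h2⟩ <;> rcases key z' hz' with ⟨h3, h4⟩ | ⟨h3, h4⟩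
      · rw [h2, h4]
      · exact absurd ⟨h1, h3⟩ hne
      · exact absurd ⟨h3, h1⟩ hne
      · rw [h2, h4]
    · intro z hz
      rcases key z hz with ⟨h1, h2⟩ | ⟨h1, h2⟩
      · rw [h2]; exact ⟨by simp, by simp [h1]⟩
      · rw [h2]; exact ⟨by simp, by simp [h1]⟩

end ExteriorJoins

end

/-!
Write `σ` for the zero set of the vertex `v`. The simplices of the triangulation are the chains of
sign vectors in `{-1, 0, 1}^m` (`mem_signedComplex_iff`), ordered by agreement outside the zero set,
so a vertex of the link is comparable with `v` in one of two ways. Either it is obtained from `v` by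
giving signs to some coordinates in `σ`: such vertices correspond to the nonzero sign vectors on
`σ`, and their chains to the simplices of the barycentric subdivision of the boundary of the cube
`[-1, 1]^σ`. Or it is obtained from `v` by killing further coordinates: such vertices correspond to
the simplices of `K` properly containing `σ`. The link is the join of these two pieces
(`mem_vertexLink_iff`). If `σ = ∅`, the first piece is empty and the second one is `K'`.

If `σ` is a `k`-simplex, a chain of `k + 1` nonempty subsets of `σ` cannot be refined below `σ`, so
the second piece is `Lk(σ', K')` (`mem_simplexLink_full_flag_iff`). In the first piece, the
boundary of the cube is replaced by the boundary of the cross-polytope, the `(k + 1)`-fold join of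
`S⁰`: its faces are also indexed by the nonzero sign vectors, so its barycentric subdivision is
the same abstract complex. Concretely, `joinVertex` sends a sign vector `y` to the barycentre
`y / ‖y‖₁` of a face of the cross-polytope and a simplex of `K` to a unit vector. The induced linear
map on the geometric realization of the abstract join is injective (`injOn_joinVertex`) and its
image is the iterated join with `S⁰` (`image_joinVertex`). Both statements reduce, after rescaling
the weights, to the fact that the chains of sign vectors triangulate the cube.

The PL homeomorphism comes from a general principle (`plHomeomorphic_image`): two injective linear
maps on the realization of a finite abstract complex have PL homeomorphic images, as each of them
induces a triangulation of its image (`linearRealization`).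
-/

noncomputable section

/-! ### Linear realizations of abstract complexes and PL homeomorphisms -/

section Realization

open PreAbstractSimplicialComplex (realization vertexSet)

theorem sum_coe_eq_sum_univ {V M : Type*} [Fintype V] [AddCommMonoid M] (s : Finset V) (f : V → M)
    (hf : ∀ a ∉ s, f a = 0) : ∑ a : s, f a = ∑ a, f a := by
  rw [Finset.sum_coe_sort s f]
  exact Finset.sum_subset (Finset.subset_univ s) fun a _ ha => hf a ha

variable {V E F : Type*} [Fintype V] [AddCommGroup E] [Module ℝ E] [AddCommGroup F] [Module ℝ F]

/-- It is enough that the barycentric coordinates vanish outside a face: the support itself need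
not be named. -/
theorem mem_realization_iff (A : PreAbstractSimplicialComplex V) (w : V → ℝ) :
    w ∈ A.realization ↔ w ∈ stdSimplex ℝ V ∧ ∃ s ∈ A.faces, ∀ a ∉ s, w a = 0 := by
  classical
  refine and_congr_right fun hw => ⟨fun ⟨s, hs, h⟩ => ⟨s, hs, fun a ha => ?_⟩, fun ⟨s, hs, h⟩ => ?_⟩
  · simpa using (h a).not.1 ha
  · refine ⟨s.filter fun a => w a ≠ 0, (A.isRelLowerSet_faces hs).2 (Finset.filter_subset _ _) ?_,
      fun a => ?_⟩
    · obtain ⟨a, -, ha⟩ := Finset.exists_ne_zero_of_sum_ne_zero (hw.2.trans_ne one_ne_zero)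
      exact ⟨a, Finset.mem_filter.2 ⟨by_contra fun h' => ha (h a h'), ha⟩⟩
    · rw [Finset.mem_filter]
      exact ⟨fun h' => h'.2, fun h' => ⟨by_contra fun h'' => h' (h a h''), h'⟩⟩

/-- The simplex spanned by the points `p a`, `a ∈ s`, is the linear image of a face of the standard
simplex, even if `p` is not injective. -/
theorem convexHull_image_eq_linearCombination (p : V → E) (s : Finset V) :
    convexHull ℝ (p '' s) =
      Fintype.linearCombination ℝ p '' {w | w ∈ stdSimplex ℝ V ∧ ∀ a ∉ s, w a = 0} := by
  classical
  apply subset_antisymm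
  · refine convexHull_min ?_ ?_
    · rintro _ ⟨a, ha, rfl⟩
      refine ⟨Pi.single a 1, ⟨single_mem_stdSimplex ℝ a, fun b hb => ?_⟩, by simp⟩
      exact Pi.single_eq_of_ne (fun h => hb (by rwa [h])) _
    · refine Convex.linear_image ?_ _
      refine (convex_stdSimplex ℝ V).inter ?_
      intro x hx y hy a b _ _ _ c hc
      simp [hx c hc, hy c hc]
  · rintro _ ⟨w, ⟨hw, h0⟩, rfl⟩
    rw [Fintype.linearCombination_apply, ← Finset.sum_subset (Finset.subset_univ s)
      (fun a _ ha => by rw [h0 a ha, zero_smul])]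
    refine (convex_convexHull ℝ _).sum_mem (fun a _ => hw.1 a) ?_
      fun a ha => subset_convexHull ℝ _ ⟨a, ha, rfl⟩
    rw [Finset.sum_subset (Finset.subset_univ s) fun a _ ha => h0 a ha, hw.2]

theorem single_mem_realization [DecidableEq V] {A : PreAbstractSimplicialComplex V} {s : Finset V}
    (hs : s ∈ A.faces) {a : V} (ha : a ∈ s) : Pi.single a 1 ∈ A.realization :=
  (mem_realization_iff A _).2 ⟨single_mem_stdSimplex ℝ a, s, hs, fun _ hb =>
    Pi.single_eq_of_ne (fun h => hb (by rwa [h])) _⟩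

theorem injOn_face {A : PreAbstractSimplicialComplex V} {p : V → E}
    (hp : InjOn (Fintype.linearCombination ℝ p) A.realization) {s : Finset V} (hs : s ∈ A.faces) :
    InjOn p s := by
  classical
  intro a ha b hb hab
  have := hp (single_mem_realization hs ha) (single_mem_realization hs hb) (by simpa using hab)
  by_contra hne
  simpa [hne] using congrFun this a

theorem affineIndependent_face {A : PreAbstractSimplicialComplex V} {p : V → E}
    (hp : InjOn (Fintype.linearCombination ℝ p) A.realization) {s : Finset V} (hs : s ∈ A.faces) :
    AffineIndependent ℝ fun a : s => p a := by
  classical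
  by_contra hdep
  -- A Radon partition gives two points of `|A|` with disjoint supports and the same image.
  obtain ⟨I, x, hx1, hx2⟩ := Convex.radon_partition hdep
  have key : ∀ J : Set s, (fun a : s => p a) '' J =
      p '' ((Finset.univ.filter (· ∈ J)).map (Function.Embedding.subtype _) : Finset V) := by
    intro J
    ext y
    simp
  rw [key, convexHull_image_eq_linearCombination] at hx1 hx2
  obtain ⟨w, ⟨hw, h0⟩, rfl⟩ := hx1
  obtain ⟨w', ⟨hw', h0'⟩, h⟩ := hx2
  have hww : w' = w := by
    refine hp ((mem_realization_iff A _).2 ⟨hw', s, hs, fun a ha => h0' a ?_⟩)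
      ((mem_realization_iff A _).2 ⟨hw, s, hs, fun a ha => h0 a ?_⟩) h
    · simp [ha]
    · simp [ha]
  subst hww
  have : ∀ a, w' a = 0 := by
    intro a
    by_cases ha : ∃ h : a ∈ s, (⟨a, h⟩ : s) ∈ I
    · obtain ⟨h, hI⟩ := ha
      exact h0' a (by simpa [h] using hI)
    · exact h0 a (by simpa using ha)
  simpa [this] using hw.2

/-- If the vertices of `A` are placed at the points `p a` in such a way that the induced linear map
`|A| → E` is injective, the simplices spanned by the images of the faces of `A` form a geometric
simplicial complex. -/
def linearRealization (A : PreAbstractSimplicialComplex V) (p : V → E)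
    (hp : InjOn (Fintype.linearCombination ℝ p) A.realization) :
    Geometry.SimplicialComplex ℝ E where
  faces := {t | ∃ s ∈ A.faces, (t : Set E) = p '' s}
  isRelLowerSet_faces := by
    classical
    rintro t ⟨s, hs, ht⟩
    refine ⟨?_, fun u hu hne => ?_⟩
    · rw [← Finset.coe_nonempty, ht]
      exact (Finset.coe_nonempty.2 (A.isRelLowerSet_faces hs).1).image p
    · have hu' : (u : Set E) ⊆ p '' s := ht ▸ Finset.coe_subset.2 hu
      have hus : (u : Set E) = p '' (s.filter fun a => p a ∈ u : Finset V) := by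
        ext y
        simp only [Finset.coe_filter, mem_image, mem_ofPred_eq]
        constructor
        · intro hy
          obtain ⟨a, ha, rfl⟩ := hu' hy
          exact ⟨a, ⟨ha, hy⟩, rfl⟩
        · rintro ⟨a, ⟨_, ha⟩, rfl⟩
          exact ha
      refine ⟨_, (A.isRelLowerSet_faces hs).2 (Finset.filter_subset _ _) ?_, hus⟩
      rw [← Finset.coe_nonempty, hus] at hne
      exact Finset.coe_nonempty.1 hne.of_image
  indep := by
    rintro t ⟨s, hs, ht⟩
    refine (affineIndependent_face hp hs).range.mono ?_
    rintro y (hy : y ∈ (t : Set E))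
    rw [ht] at hy
    obtain ⟨a, ha, rfl⟩ := hy
    exact ⟨⟨a, ha⟩, rfl⟩
  inter_subset_convexHull := by
    classical
    rintro t t' ⟨s, hs, ht⟩ ⟨s', hs', ht'⟩
    rw [ht, ht', convexHull_image_eq_linearCombination, convexHull_image_eq_linearCombination]
    rintro x ⟨⟨w, ⟨hw, h0⟩, rfl⟩, ⟨w', ⟨hw', h0'⟩, h⟩⟩
    obtain rfl := hp ((mem_realization_iff A _).2 ⟨hw', s', hs', h0'⟩)
      ((mem_realization_iff A _).2 ⟨hw, s, hs, h0⟩) h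
    refine convexHull_mono (image_inter_subset p s s') ?_
    rw [← Finset.coe_inter, convexHull_image_eq_linearCombination]
    refine ⟨w', ⟨hw', fun a ha => ?_⟩, rfl⟩
    by_cases has : a ∈ s
    · exact h0' a fun h => ha (Finset.mem_inter.2 ⟨has, h⟩)
    · exact h0 a has

theorem space_linearRealization (A : PreAbstractSimplicialComplex V) (p : V → E)
    (hp : InjOn (Fintype.linearCombination ℝ p) A.realization) :
    (linearRealization A p hp).space = Fintype.linearCombination ℝ p '' A.realization := by
  classical
  ext x
  rw [Geometry.SimplicialComplex.mem_space_iff]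
  constructor
  · rintro ⟨t, ⟨s, hs, ht⟩, hx⟩
    rw [ht, convexHull_image_eq_linearCombination] at hx
    obtain ⟨w, ⟨hw, h0⟩, rfl⟩ := hx
    exact ⟨w, (mem_realization_iff A _).2 ⟨hw, s, hs, h0⟩, rfl⟩
  · rintro ⟨w, hw, rfl⟩
    obtain ⟨hw, s, hs, h0⟩ := (mem_realization_iff A _).1 hw
    refine ⟨s.image p, ⟨s, hs, Finset.coe_image⟩, ?_⟩
    rw [Finset.coe_image, convexHull_image_eq_linearCombination]
    exact ⟨w, ⟨hw, h0⟩, rfl⟩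

theorem finite_faces_linearRealization (A : PreAbstractSimplicialComplex V) (p : V → E)
    (hp : InjOn (Fintype.linearCombination ℝ p) A.realization) :
    (linearRealization A p hp).faces.Finite := by
  classical
  refine (A.faces.toFinite.image fun s => s.image p).subset ?_
  rintro t ⟨s, hs, ht⟩
  exact ⟨s, hs, Finset.coe_injective (by rw [Finset.coe_image, ht])⟩

/-- Conversely, if `p` places the faces of `A` on simplices of a geometric simplicial complex,
without identifying vertices, the induced linear map on `|A|` is injective: barycentric coordinates
in a geometric simplicial complex are unique. -/
theorem injOn_linearCombination (S : Geometry.SimplicialComplex ℝ E)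
    (A : PreAbstractSimplicialComplex V) (p : V → E) (hinj : InjOn p A.vertexSet)
    (hp : ∀ s ∈ A.faces, ∃ t ∈ S.faces, (t : Set E) = p '' s) :
    InjOn (Fintype.linearCombination ℝ p) A.realization := by
  classical
  have hsub : ∀ s ∈ A.faces, (s : Set V) ⊆ A.vertexSet := fun s hs a ha =>
    (A.isRelLowerSet_faces hs).2 (Finset.singleton_subset_iff.2 ha) (Finset.singleton_nonempty a)
  have huniq : ∀ s ∈ A.faces, ∀ w u : V → ℝ, w ∈ stdSimplex ℝ V → u ∈ stdSimplex ℝ V →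
      (∀ a ∉ s, w a = 0) → (∀ a ∉ s, u a = 0) →
      Fintype.linearCombination ℝ p w = Fintype.linearCombination ℝ p u → w = u := by
    intro s hs w u hw hu h0 h0' h
    obtain ⟨t, ht, hts⟩ := hp s hs
    have hmem : ∀ a : s, p a ∈ t := fun a => by
      rw [← Finset.mem_coe, hts]
      exact ⟨a, a.2, rfl⟩
    let ι : s ↪ t := ⟨fun a => ⟨p a, hmem a⟩, fun a b hab =>
      Subtype.ext (hinj (hsub s hs a.2) (hsub s hs b.2) (congrArg Subtype.val hab))⟩
    have hind : AffineIndependent ℝ fun a : s => p a := (S.indep ht).comp_embedding ι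
    have := affineIndependent_iff.1 hind Finset.univ (fun a => w a - u a) ?_ ?_
    · ext a
      by_cases ha : a ∈ s
      · exact sub_eq_zero.1 (this ⟨a, ha⟩ (Finset.mem_univ _))
      · rw [h0 a ha, h0' a ha]
    · have hs' := sum_coe_eq_sum_univ s (fun a => w a - u a) fun a ha => by
        rw [h0 a ha, h0' a ha, sub_zero]
      refine hs'.trans ?_
      rw [Finset.sum_sub_distrib, hw.2, hu.2, sub_self]
    · have hs' := sum_coe_eq_sum_univ s (fun a => (w a - u a) • p a) fun a ha => by
        rw [h0 a ha, h0' a ha, sub_zero, zero_smul]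
      refine hs'.trans ?_
      simp only [sub_smul, Finset.sum_sub_distrib]
      exact sub_eq_zero.2 h
  intro w hw w' hw' h
  obtain ⟨hw, s, hs, h0⟩ := (mem_realization_iff A _).1 hw
  obtain ⟨hw', s', hs', h0'⟩ := (mem_realization_iff A _).1 hw'
  obtain ⟨t, ht, hts⟩ := hp s hs
  obtain ⟨t', ht', hts'⟩ := hp s' hs'
  have hx : Fintype.linearCombination ℝ p w ∈
      convexHull ℝ (t : Set E) ∩ convexHull ℝ (t' : Set E) := by
    rw [hts, hts', convexHull_image_eq_linearCombination, convexHull_image_eq_linearCombination]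
    exact ⟨⟨w, ⟨hw, h0⟩, rfl⟩, ⟨w', ⟨hw', h0'⟩, h.symm⟩⟩
  have hx' := S.inter_subset_convexHull ht ht' hx
  rw [hts, hts', ← hinj.image_inter (hsub s hs) (hsub s' hs'), ← Finset.coe_inter,
    convexHull_image_eq_linearCombination] at hx'
  obtain ⟨u, ⟨hu, hu0⟩, hux⟩ := hx'
  have e1 : w = u := huniq s hs w u hw hu h0
    (fun a ha => hu0 a fun h => ha (Finset.mem_inter.1 h).1) hux.symm
  have e2 : w' = u := huniq s' hs' w' u hw' hu h0'
    (fun a ha => hu0 a fun h => ha (Finset.mem_inter.1 h).2) (h.symm.trans hux.symm)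
  rw [e1, e2]

theorem isCompact_realization (A : PreAbstractSimplicialComplex V) : IsCompact A.realization := by
  have : A.realization = ⋃ s ∈ A.faces, stdSimplex ℝ V ∩ ⋂ a ∉ s, {w | w a = 0} := by
    ext w
    rw [mem_realization_iff]
    simp only [mem_iUnion, mem_inter_iff, mem_iInter, mem_ofPred_eq, exists_prop]
    tauto
  rw [this]
  refine A.faces.toFinite.isCompact_biUnion fun s _ => (isCompact_stdSimplex ℝ V).inter_right ?_
  exact isClosed_biInter fun a _ => isClosed_singleton.preimage (continuous_apply a)

variable [TopologicalSpace E] [IsTopologicalAddGroup E] [ContinuousSMul ℝ E] [T2Space E]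
  [TopologicalSpace F] [IsTopologicalAddGroup F] [ContinuousSMul ℝ F] [T2Space F]

/-- An injective linear map on `|A|` is a homeomorphism onto its image, as `|A|` is compact. -/
def realizationHomeomorph (A : PreAbstractSimplicialComplex V) (p : V → E)
    (hp : InjOn (Fintype.linearCombination ℝ p) A.realization) :
    A.realization ≃ₜ (Fintype.linearCombination ℝ p '' A.realization : Set E) :=
  haveI := isCompact_iff_compactSpace.1 (isCompact_realization A)
  Continuous.homeoOfEquivCompactToT2 (f := Equiv.Set.imageOfInjOn _ _ hp) <| by
    refine Continuous.subtype_mk ?_ _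
    have : Continuous (Fintype.linearCombination ℝ p) := by
      simp only [funext (Fintype.linearCombination_apply ℝ p)]
      fun_prop
    exact this.comp continuous_subtype_val

/-- Two linear realizations of the same finite abstract complex are PL homeomorphic. -/
theorem plHomeomorphic_image (A : PreAbstractSimplicialComplex V) (p : V → E) (q : V → F)
    (hp : InjOn (Fintype.linearCombination ℝ p) A.realization)
    (hq : InjOn (Fintype.linearCombination ℝ q) A.realization) :
    PLHomeomorphic (Fintype.linearCombination ℝ p '' A.realization)
      (Fintype.linearCombination ℝ q '' A.realization) := by
  classical
  set P := Fintype.linearCombination ℝ p with hP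
  set Q := Fintype.linearCombination ℝ q with hQ
  have hleft : ∀ w ∈ A.realization, Function.invFunOn P A.realization (P w) = w := fun w hw =>
    hp.leftInvOn_invFunOn hw
  let f : E → F := fun x => Q (Function.invFunOn P A.realization x)
  have hf : ∀ w ∈ A.realization, f (P w) = Q w := fun w hw => by simp only [f, hleft w hw]
  have hfp : ∀ s ∈ A.faces, ∀ a ∈ s, f (p a) = q a := fun s hs a ha => by
    have := hf _ (single_mem_realization hs ha)
    simpa [hP, hQ] using this
  refine ⟨(realizationHomeomorph A p hp).symm.trans (realizationHomeomorph A q hq),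
    ⟨linearRealization A p hp, space_linearRealization A p hp⟩,
    ⟨linearRealization A q hq, space_linearRealization A q hq⟩, f,
    finite_faces_linearRealization A p hp, finite_faces_linearRealization A q hq, ?_, ?_⟩
  · intro x
    obtain ⟨w, rfl⟩ := (realizationHomeomorph A p hp).surjective x
    rw [Homeomorph.trans_apply, Homeomorph.symm_apply_apply]
    exact hf w w.2
  · rintro t ⟨s, hs, ht⟩
    obtain rfl : t = s.image p := Finset.coe_injective (by rw [ht, Finset.coe_image])
    refine ⟨⟨s, hs, ?_⟩, fun w w0 w1 => ?_⟩
    · ext y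
      simp only [Finset.coe_image, mem_image, Finset.mem_coe, exists_exists_and_eq_and]
      exact exists_congr fun a => and_congr_right fun ha => by rw [hfp s hs a ha]
    · have hps := injOn_face hp hs
      rw [Finset.sum_image hps] at w1 ⊢
      rw [Finset.sum_image hps]
      let u : V → ℝ := fun a => if a ∈ s then w (p a) else 0
      have hu : u ∈ A.realization := by
        refine (mem_realization_iff A u).2 ⟨⟨fun a => ?_, ?_⟩, s, hs, fun a ha => if_neg ha⟩
        · by_cases ha : a ∈ s
          · simpa [u, ha] using w0 _ (Finset.mem_image_of_mem p ha)
          · simp [u, ha]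
        · simpa [u, Finset.sum_ite_mem] using w1
      have hPu : P u = ∑ a ∈ s, w (p a) • p a := by
        simp [hP, u, Fintype.linearCombination_apply, ite_smul]
      have hQu : Q u = ∑ a ∈ s, w (p a) • q a := by
        simp [hQ, u, Fintype.linearCombination_apply, ite_smul]
      rw [← hPu, hf u hu, hQu]
      exact Finset.sum_congr rfl fun a ha => by rw [hfp s hs a ha]

end Realization

/-! ### Coordinates on joins with copies of `S⁰` -/

section Join

variable {n : ℕ} {V : Type*}

/-- The cone over `|A|` with apex `0`. -/
def coneOver (A : PreAbstractSimplicialComplex V) : Set (V → ℝ) :=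
  {z | (∀ a, 0 ≤ z a) ∧ (z = 0 ∨ ∃ s ∈ A.faces, ∀ a ∉ s, z a = 0)}

theorem smul_mem_coneOver {A : PreAbstractSimplicialComplex V} {z : V → ℝ} (hz : z ∈ coneOver A)
    {b : ℝ} (hb : 0 ≤ b) : b • z ∈ coneOver A := by
  refine ⟨fun a => mul_nonneg hb (hz.1 a), ?_⟩
  rcases hz.2 with rfl | ⟨s, hs, h⟩
  · exact Or.inl (smul_zero b)
  · exact Or.inr ⟨s, hs, fun a ha => by simp [h a ha]⟩

variable [Fintype V]

theorem taxicab_nonneg (p : (Fin n → ℝ) × (V → ℝ)) : 0 ≤ taxicab p :=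
  add_nonneg (Finset.sum_nonneg fun _ _ => abs_nonneg _) (Finset.sum_nonneg fun _ _ => abs_nonneg _)

theorem taxicab_eq_zero {p : (Fin n → ℝ) × (V → ℝ)} (hp : taxicab p = 0) : p = 0 := by
  have h1 : 0 ≤ ∑ j, |p.1 j| := Finset.sum_nonneg fun _ _ => abs_nonneg _
  have h2 : 0 ≤ ∑ a, |p.2 a| := Finset.sum_nonneg fun _ _ => abs_nonneg _
  have e1 : ∑ j, |p.1 j| = 0 := by unfold taxicab at hp; linarith
  have e2 : ∑ a, |p.2 a| = 0 := by unfold taxicab at hp; linarith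
  rw [Finset.sum_eq_zero_iff_of_nonneg fun _ _ => abs_nonneg _] at e1 e2
  refine Prod.ext (funext fun j => ?_) (funext fun a => ?_)
  · simpa using e1 j (Finset.mem_univ _)
  · simpa using e2 a (Finset.mem_univ _)

/-- The iterated join consists of the points of `ℓ¹` norm `1` whose second component lies in
the cone over `|A|`, the coordinates without a copy of `S⁰` being zero. -/
theorem mem_foldr_join_iff (A : PreAbstractSimplicialComplex V) (l : List (Fin n)) (hl : l.Nodup) :
    ∀ p : (Fin n → ℝ) × (V → ℝ), p ∈ (l.map (zeroSphere (V → ℝ))).foldr polyhedralJoin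
      ((fun y => (0, y)) '' A.realization) ↔
        (∀ j ∉ l, p.1 j = 0) ∧ taxicab p = 1 ∧ p.2 ∈ coneOver A := by
  intro p
  suffices h : (p ∈ (l.map (zeroSphere (V → ℝ))).foldr polyhedralJoin
      ((fun y => (0, y)) '' A.realization) → p.2 ∈ coneOver A) ∧
      ((∀ j ∉ l, p.1 j = 0) → taxicab p = 1 → p.2 ∈ coneOver A →
        p ∈ (l.map (zeroSphere (V → ℝ))).foldr polyhedralJoin
          ((fun y => (0, y)) '' A.realization)) by
    have h' := foldr_join_coords A.realization (fun _ hx => hx.1) l hl p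
    exact ⟨fun hp => ⟨(h' hp).1, (h' hp).2, h.1 hp⟩, fun hp => h.2 hp.1 hp.2.1 hp.2.2⟩
  induction l generalizing p with
  | nil =>
    constructor
    · rintro ⟨y, hy, rfl⟩
      obtain ⟨h, s, hs, h0⟩ := (mem_realization_iff A y).1 hy
      exact ⟨h.1, Or.inr ⟨s, hs, h0⟩⟩
    · intro h0 h1 h2
      have hp1 : p.1 = 0 := funext fun j => h0 j (by simp)
      have hsum : ∑ a, p.2 a = 1 := by
        rw [← h1, taxicab, hp1]
        simp [fun a => abs_of_nonneg (h2.1 a)]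
      refine ⟨p.2, (mem_realization_iff A _).2 ⟨⟨h2.1, hsum⟩, ?_⟩, Prod.ext hp1.symm rfl⟩
      rcases h2.2 with h | h
      · simp [h] at hsum
      · exact h
  | cons i l ih =>
    have hi := (List.nodup_cons.1 hl).1
    have ih' := ih (List.nodup_cons.1 hl).2
    rw [List.map_cons, List.foldr_cons]
    constructor
    · rintro ((hp | hp) | hp)
      · obtain ⟨ε, hε, rfl⟩ := (mem_zeroSphere_iff i p).1 hp
        exact ⟨fun _ => le_rfl, Or.inl rfl⟩
      · exact (ih' p).1 hp
      · obtain ⟨x, hx, y, hy, a, b, ha, hb, hab, rfl⟩ := mem_convexJoin.1 hp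
        obtain ⟨ε, hε, rfl⟩ := (mem_zeroSphere_iff i x).1 hx
        simpa using smul_mem_coneOver ((ih' y).1 hy) hb
    · intro h0 h1 h2
      by_cases hpi : p.1 i = 0
      · refine Or.inl (Or.inr ((ih' p).2 (fun j hj => ?_) h1 h2))
        by_cases hji : j = i
        · rw [hji, hpi]
        · exact h0 j (by simp [hji, hj])
      -- `p` lies on the segment from the vertex `±e_i` to the normalization of the remaining part.
      obtain ⟨ε, a, hε, ha, hεa⟩ : ∃ ε a : ℝ, |ε| = 1 ∧ 0 ≤ a ∧ a * ε = p.1 i := by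
        refine ⟨p.1 i / |p.1 i|, |p.1 i|, ?_, abs_nonneg _, ?_⟩
        · rw [abs_div, abs_abs, div_self (abs_ne_zero.2 hpi)]
        · rw [mul_div_cancel₀ _ (abs_ne_zero.2 hpi)]
      let x : (Fin n → ℝ) × (V → ℝ) := (Pi.single i ε, 0)
      let y : (Fin n → ℝ) × (V → ℝ) := p - a • x
      have hx : x ∈ zeroSphere (V → ℝ) i := (mem_zeroSphere_iff i x).2 ⟨ε, hε, rfl⟩
      have hyi : y.1 i = 0 := by simp [y, x, hεa]
      have hyl : ∀ j ∉ l, y.1 j = 0 := fun j hj => by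
        by_cases hji : j = i
        · rw [hji, hyi]
        · simp [y, x, hji, h0 j (by simp [hji, hj])]
      have hy2 : y.2 = p.2 := by simp [y, x]
      have hp : p = a • x + y := by simp [y]
      have hsum : a + taxicab y = 1 := by
        have := taxicab_combination i ε a 1 hε ha zero_le_one y hyi
        rw [one_smul, one_mul, ← hp, h1] at this
        exact this.symm
      rcases (taxicab_nonneg y).eq_or_lt with hy0 | hy0
      · left; left
        rw [hp, taxicab_eq_zero hy0.symm, show a = 1 by linarith, one_smul, add_zero]
        exact hx
      · right
        refine mem_convexJoin.2 ⟨x, hx, (taxicab y)⁻¹ • y, (ih' _).2 (fun j hj => ?_) ?_ ?_,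
          a, taxicab y, ha, hy0.le, hsum, ?_⟩
        · simp [hyl j hj]
        · have := taxicab_combination i ε 0 (taxicab y)⁻¹ hε le_rfl (inv_nonneg.2 hy0.le) y hyi
          rwa [zero_smul, zero_add, zero_add, inv_mul_cancel₀ hy0.ne'] at this
        · exact smul_mem_coneOver (hy2.symm ▸ h2 : y.2 ∈ coneOver A) (inv_nonneg.2 hy0.le)
        · rw [smul_inv_smul₀ hy0.ne', ← hp]

theorem mem_zeroSpheresJoin_iff (A : PreAbstractSimplicialComplex V)
    (p : (Fin n → ℝ) × (V → ℝ)) :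
    p ∈ zeroSpheresJoin n A.realization ↔ taxicab p = 1 ∧ p.2 ∈ coneOver A := by
  rw [zeroSpheresJoin, mem_foldr_join_iff A _ (List.nodup_finRange n)]
  simp

end Join

/-! ### Chains of sign vectors -/

section SignVectors

variable {m : ℕ}

/-- The point of `{-1, 0, 1}^m` given by a sign vector. -/
def signVec (x : Fin m → SignType) : Fin m → ℝ := fun i => (x i : ℝ)

/-- The zero set of a sign vector. -/
def signZeros (x : Fin m → SignType) : Finset (Fin m) := Finset.univ.filter fun i => x i = 0

@[simp] theorem mem_signZeros {x : Fin m → SignType} {i : Fin m} : i ∈ signZeros x ↔ x i = 0 := by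
  simp [signZeros]

/-- The face order on sign vectors: `y` agrees with `x` wherever `x` does not vanish, that is, the
face of the cube with centre `y` is contained in the face with centre `x`. -/
def SignLE (x y : Fin m → SignType) : Prop := ∀ i, x i ≠ 0 → y i = x i

/-- A set of sign vectors whose members are pairwise comparable in the face order. -/
def IsSignChain (s : Set (Fin m → SignType)) : Prop := ∀ x ∈ s, ∀ y ∈ s, SignLE x y ∨ SignLE y x

theorem signVec_injective : Function.Injective (signVec : (Fin m → SignType) → Fin m → ℝ) := by
  intro x y h
  ext i
  have hi := congrFun h i
  simp only [signVec] at hi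
  generalize x i = a at *
  generalize y i = b at *
  cases a <;> cases b <;> norm_num at hi <;> rfl

theorem signLE_refl (x : Fin m → SignType) : SignLE x x := fun _ _ => rfl

theorem SignLE.signZeros_subset {x y : Fin m → SignType} (h : SignLE x y) :
    signZeros y ⊆ signZeros x := by
  intro i hi
  rw [mem_signZeros] at *
  by_contra hx
  exact hx ((h i hx).symm.trans hi)

theorem signVec_zero : signVec (0 : Fin m → SignType) = 0 := by
  ext i
  simp [signVec]

/-- The members of a chain of sign vectors agree with a common choice of signs wherever they do not
vanish. -/
theorem IsSignChain.exists_units {s : Set (Fin m → SignType)} (hs : IsSignChain s) :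
    ∃ g : Fin m → ℤˣ, ∀ x ∈ s, ∀ i, x i ≠ 0 → signVec x i = ((g i : ℤ) : ℝ) := by
  have : ∀ i, ∃ g : ℤˣ, ∀ x ∈ s, x i ≠ 0 → signVec x i = ((g : ℤ) : ℝ) := by
    intro i
    by_cases h : ∃ x ∈ s, x i ≠ 0
    · obtain ⟨x, hx, hxi⟩ := h
      obtain ⟨g, hg⟩ : ∃ g : ℤˣ, signVec x i = ((g : ℤ) : ℝ) := by
        simp only [signVec]
        generalize x i = a at *
        cases a
        · exact absurd rfl hxi
        · exact ⟨-1, by simp⟩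
        · exact ⟨1, by simp⟩
      refine ⟨g, fun y hy hyi => ?_⟩
      rw [← hg]
      rcases hs x hx y hy with h | h
      · simp only [signVec, h i hxi]
      · simp only [signVec, h i hyi]
    · exact ⟨1, fun x hx hxi => absurd ⟨x, hx, hxi⟩ h⟩
  choose g hg using this
  exact ⟨g, fun x hx i => hg i x hx⟩

/-- No cancellation occurs in a nonnegative combination of a chain of sign vectors. -/
theorem abs_linearCombination_signVec {s : Set (Fin m → SignType)} (hs : IsSignChain s)
    (u : (Fin m → SignType) → ℝ) (hu : ∀ x, 0 ≤ u x) (h0 : ∀ x ∉ s, u x = 0) (i : Fin m) :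
    |∑ x, u x * signVec x i| = ∑ x, u x * |signVec x i| := by
  obtain ⟨g, hg⟩ := hs.exists_units
  have : ∀ x, u x * signVec x i = ((g i : ℤ) : ℝ) * (u x * |signVec x i|) := by
    intro x
    by_cases hx : x ∈ s
    · by_cases hxi : x i = 0
      · simp [signVec, hxi]
      · rw [hg x hx i hxi, abs_sign_cast]
        ring
    · simp [h0 x hx]
  rw [Finset.sum_congr rfl fun x _ => this x, ← Finset.mul_sum, abs_mul, abs_sign_cast, one_mul]
  exact abs_of_nonneg (Finset.sum_nonneg fun x _ => mul_nonneg (hu x) (abs_nonneg _))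

/-- The abstract complex of nonempty chains of sign vectors with zero sets in `K`. -/
def signChainComplex (K : PreAbstractSimplicialComplex (Fin m)) :
    PreAbstractSimplicialComplex (Fin m → SignType) where
  faces := {s | s.Nonempty ∧ IsSignChain (s : Set (Fin m → SignType)) ∧
    ∀ x ∈ s, signZeros x = ∅ ∨ signZeros x ∈ K.faces}
  isRelLowerSet_faces := fun _ hs => ⟨hs.1, fun _ ht hn =>
    ⟨hn, fun x hx y hy => hs.2.1 x (ht hx) y (ht hy), fun x hx => hs.2.2 x (ht hx)⟩⟩

/-- The simplices of the triangulation are the chains of sign vectors: the group element `g` can be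
recovered from the signs, up to coordinates on which all vertices vanish. -/
theorem mem_signedComplex_iff (K : PreAbstractSimplicialComplex (Fin m))
    (t : Finset (Fin m → ℝ)) : t ∈ (signedComplex K).faces ↔
      ∃ s ∈ (signChainComplex K).faces, (t : Set (Fin m → ℝ)) = signVec '' s := by
  classical
  constructor
  · intro ht
    obtain ⟨g, c, hc, rfl⟩ := mem_iUnion.1 ht
    let r : Finset (Fin m) → Fin m → SignType := fun τ i =>
      if i ∈ τ then 0 else SignType.sign (g i : ℤ)
    have hg : ∀ i, (SignType.sign (g i : ℤ) : ℝ) = ((g i : ℤ) : ℝ) ∧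
        SignType.sign (g i : ℤ) ≠ 0 := by
      intro i
      rcases Int.units_eq_one_or (g i) with h | h <;> simp [h]
    have hr : ∀ τ, signVec (r τ) = signAct g (cubePoint τ) := by
      intro τ
      ext i
      by_cases h : i ∈ τ <;> simp [signVec, r, signAct, cubePoint, h, (hg i).1]
    have hz : ∀ τ, signZeros (r τ) = τ := by
      intro τ
      ext i
      by_cases h : i ∈ τ <;> simp [r, h, (hg i).2]
    have hle : ∀ τ τ', τ ⊆ τ' → SignLE (r τ') (r τ) := by
      intro τ τ' h i hi
      by_cases h' : i ∈ τ'
      · simp [r, h'] at hi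
      · have h'' : i ∉ τ := fun h'' => h' (h h'')
        simp [r, h', h'']
    refine ⟨c.image r, ⟨hc.1.image _, ?_, ?_⟩, ?_⟩
    · simp only [IsSignChain, Finset.coe_image, forall_mem_image]
      intro τ hτ τ' hτ'
      exact (hc.2.1.total hτ' hτ).imp (hle _ _) (hle _ _)
    · intro x hx
      obtain ⟨τ, hτ, rfl⟩ := Finset.mem_image.1 hx
      rw [hz]
      exact hc.2.2 τ hτ
    · rw [Finset.coe_image, Finset.coe_image, image_image]
      simp only [hr]
  · rintro ⟨s, ⟨hne, hch, hK⟩, ht⟩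
    obtain ⟨g, hg⟩ := hch.exists_units
    refine mem_iUnion.2 ⟨g, s.image signZeros, ⟨hne.image _, ?_, ?_⟩, ?_⟩
    · rw [Finset.coe_image]
      rintro _ ⟨x, hx, rfl⟩ _ ⟨y, hy, rfl⟩ -
      exact ((hch x hx y hy).imp SignLE.signZeros_subset SignLE.signZeros_subset).symm
    · intro σ hσ
      obtain ⟨x, hx, rfl⟩ := Finset.mem_image.1 hσ
      exact hK x hx
    · refine Finset.coe_injective ?_
      rw [ht, Finset.coe_image, Finset.coe_image, image_image]
      refine image_congr fun x hx => ?_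
      ext i
      by_cases h : x i = 0
      · simp [signVec, signAct, cubePoint, h]
      · simp [signAct, cubePoint, h, hg x hx i h]

theorem injOn_signChainComplex (K : PreAbstractSimplicialComplex (Fin m)) :
    InjOn (Fintype.linearCombination ℝ signVec) (signChainComplex K).realization :=
  injOn_linearCombination (signedComplex K) _ _ signVec_injective.injOn fun s hs => by
    classical
    exact ⟨s.image signVec, (mem_signedComplex_iff K _).2 ⟨s, hs, Finset.coe_image⟩,
      Finset.coe_image⟩

/-- Every point of the cube is a convex combination of a chain of sign vectors. -/
theorem exists_signVec_combination (y : Fin m → ℝ) (hy : ∀ i, |y i| ≤ 1) :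
    ∃ u ∈ (signChainComplex (⊤ : PreAbstractSimplicialComplex (Fin m))).realization,
      Fintype.linearCombination ℝ signVec u = y := by
  have hmem : y ∈ realMomentAngleComplex (⊤ : PreAbstractSimplicialComplex (Fin m)) := by
    refine (mem_realMomentAngleComplex_iff _ y).2
      ⟨hy, Finset.univ.filter fun i => 0 < 1 - |y i|, ?_, fun i => by simp⟩
    exact Finset.eq_empty_or_nonempty _
  rw [← (momentAngleTriangulation _).space_eq, Geometry.SimplicialComplex.mem_space_iff] at hmem
  obtain ⟨t, ht, hyt⟩ := hmem
  obtain ⟨s, hs, hts⟩ := (mem_signedComplex_iff _ t).1 ht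
  rw [hts, convexHull_image_eq_linearCombination] at hyt
  obtain ⟨u, ⟨hu, h0⟩, rfl⟩ := hyt
  exact ⟨u, (mem_realization_iff _ u).2 ⟨hu, s, hs, h0⟩, rfl⟩

end SignVectors

/-! ### The link of a vertex as a join -/

section Link

variable {m n : ℕ}

/-- The join of the barycentric subdivision of the boundary of the cube `[-1,1]^n`, given by the
chains of nonzero sign vectors, with the complex of chains of simplices of `K` properly containing
`σ`. For `n = |σ|` it is isomorphic to the link of a vertex with zero set `σ`. -/
def linkModel (K : PreAbstractSimplicialComplex (Fin m)) (σ : Finset (Fin m)) (n : ℕ) :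
    PreAbstractSimplicialComplex ((Fin n → SignType) ⊕ Finset (Fin m)) where
  faces := {s | s.Nonempty ∧ IsSignChain {y | Sum.inl y ∈ s} ∧ (∀ y, Sum.inl y ∈ s → y ≠ 0) ∧
    IsChain (· ⊆ ·) {τ : Finset (Fin m) | Sum.inr τ ∈ s} ∧
    ∀ τ, Sum.inr τ ∈ s → τ ∈ K.faces ∧ σ ⊂ τ}
  isRelLowerSet_faces := by
    intro s hs
    exact ⟨hs.1, fun t ht hn => ⟨hn, fun x hx y hy => hs.2.1 x (ht hx) y (ht hy),
      fun y hy => hs.2.2.1 y (ht hy), hs.2.2.2.1.mono fun _ hτ => ht hτ,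
      fun τ hτ => hs.2.2.2.2 τ (ht hτ)⟩⟩

/-- The vertex of the link of `v` corresponding to a vertex of `linkModel`: a sign vector replaces
the vanishing coordinates of `v`, and a simplex `τ` makes the coordinates in `τ` vanish. -/
def linkVertex {σ : Finset (Fin m)} (e : Fin n ≃ {i // i ∈ σ}) (v : Fin m → SignType) :
    (Fin n → SignType) ⊕ Finset (Fin m) → Fin m → SignType
  | .inl y => fun i => if h : i ∈ σ then y (e.symm ⟨i, h⟩) else v i
  | .inr τ => fun i => if i ∈ τ then 0 else v i

variable {σ : Finset (Fin m)} (e : Fin n ≃ {i // i ∈ σ}) {v : Fin m → SignType}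

theorem linkVertex_inl_apply (y : Fin n → SignType) (j : Fin n) :
    linkVertex e v (.inl y) (e j) = y j := by
  simp [linkVertex]

theorem linkVertex_inl_of_notMem (y : Fin n → SignType) {i : Fin m} (hi : i ∉ σ) :
    linkVertex e v (.inl y) i = v i := by
  simp [linkVertex, hi]

theorem signLE_linkVertex_inl_iff (y y' : Fin n → SignType) :
    SignLE (linkVertex e v (.inl y)) (linkVertex e v (.inl y')) ↔ SignLE y y' := by
  constructor
  · intro h j hj
    have := h (e j)
    rw [linkVertex_inl_apply, linkVertex_inl_apply] at this
    exact this hj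
  · intro h i hi
    by_cases hiσ : i ∈ σ
    · obtain ⟨j, hj⟩ := e.surjective ⟨i, hiσ⟩
      obtain rfl : (e j : Fin m) = i := by rw [hj]
      rw [linkVertex_inl_apply] at hi ⊢
      rw [linkVertex_inl_apply]
      exact h j hi
    · rw [linkVertex_inl_of_notMem e y hiσ, linkVertex_inl_of_notMem e y' hiσ]

theorem signLE_linkVertex_inl (hv : ∀ i, i ∈ σ ↔ v i = 0) (y : Fin n → SignType) :
    SignLE v (linkVertex e v (.inl y)) := fun _ hi =>
  linkVertex_inl_of_notMem e y fun h => hi ((hv _).1 h)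

theorem signLE_linkVertex_inr (τ : Finset (Fin m)) : SignLE (linkVertex e v (.inr τ)) v := by
  intro i hi
  by_cases h : i ∈ τ
  · simp [linkVertex, h] at hi
  · simp [linkVertex, h]

theorem signLE_linkVertex_inr_inl {τ : Finset (Fin m)} (hτ : σ ⊆ τ) (y : Fin n → SignType) :
    SignLE (linkVertex e v (.inr τ)) (linkVertex e v (.inl y)) := by
  intro i hi
  by_cases h : i ∈ τ
  · simp [linkVertex, h] at hi
  · rw [linkVertex_inl_of_notMem e y fun h' => h (hτ h')]
    simp [linkVertex, h]

theorem signZeros_linkVertex_inr (hv : ∀ i, i ∈ σ ↔ v i = 0) {τ : Finset (Fin m)} (hτ : σ ⊆ τ) :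
    signZeros (linkVertex e v (.inr τ)) = τ := by
  ext i
  by_cases h : i ∈ τ
  · simp [linkVertex, h]
  · have hi : v i ≠ 0 := fun h' => h (hτ ((hv i).2 h'))
    simp [linkVertex, h, hi]

theorem signLE_linkVertex_inr_of_subset {τ τ' : Finset (Fin m)} (h : τ' ⊆ τ) :
    SignLE (linkVertex e v (.inr τ)) (linkVertex e v (.inr τ')) := by
  intro i hi
  by_cases hi' : i ∈ τ
  · simp [linkVertex, hi'] at hi
  · have : i ∉ τ' := fun h' => hi' (h h')
    simp [linkVertex, hi', this]

/-- The vertices of the link above `v` in the face order. -/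
theorem exists_eq_linkVertex_inl (hv : ∀ i, i ∈ σ ↔ v i = 0) {x : Fin m → SignType}
    (hx : SignLE v x) (hne : x ≠ v) :
    ∃ y : Fin n → SignType, y ≠ 0 ∧ linkVertex e v (.inl y) = x := by
  have hxy : linkVertex e v (.inl fun j => x (e j)) = x := by
    ext i
    by_cases h : i ∈ σ
    · simp [linkVertex, h]
    · rw [linkVertex_inl_of_notMem e _ h, hx i fun h' => h ((hv i).2 h')]
  refine ⟨fun j => x (e j), fun h0 => hne ?_, hxy⟩
  rw [h0] at hxy
  rw [← hxy]
  ext i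
  by_cases h : i ∈ σ
  · simp [linkVertex, h, (hv i).1 h]
  · rw [linkVertex_inl_of_notMem e _ h]

/-- The vertices of the link below `v` in the face order. -/
theorem exists_eq_linkVertex_inr (hv : ∀ i, i ∈ σ ↔ v i = 0) {x : Fin m → SignType}
    (hx : SignLE x v) (hne : x ≠ v) :
    σ ⊂ signZeros x ∧ linkVertex e v (.inr (signZeros x)) = x := by
  have hxv : linkVertex e v (.inr (signZeros x)) = x := by
    ext i
    by_cases h : x i = 0
    · simp [linkVertex, h]
    · simp [linkVertex, h, hx i h]
  have hsub : σ ⊆ signZeros x := fun i hi => by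
    rw [mem_signZeros]
    by_contra h
    exact h ((hx i h).symm.trans ((hv i).1 hi))
  refine ⟨hsub.ssubset_of_ne fun h => hne ?_, hxv⟩
  rw [← hxv, ← h]
  ext i
  by_cases h : i ∈ σ
  · simp [linkVertex, h, (hv i).1 h]
  · simp [linkVertex, h]

theorem linkVertex_ne (hv : ∀ i, i ∈ σ ↔ v i = 0) {K : PreAbstractSimplicialComplex (Fin m)}
    {s : Finset ((Fin n → SignType) ⊕ Finset (Fin m))} (hs : s ∈ (linkModel K σ n).faces)
    {a : (Fin n → SignType) ⊕ Finset (Fin m)} (ha : a ∈ s) : linkVertex e v a ≠ v := by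
  intro h
  rcases a with y | τ
  · refine hs.2.2.1 y ha (funext fun j => ?_)
    rw [← linkVertex_inl_apply e (v := v) y j, h]
    exact (hv _).1 (e j).2
  · have hστ := (hs.2.2.2.2 τ ha).2
    have hz := signZeros_linkVertex_inr e hv hστ.1
    rw [h] at hz
    refine hστ.2 fun i hi => ?_
    rw [← hz, mem_signZeros] at hi
    exact (hv i).2 hi

theorem isSignChain_linkVertex (hv : ∀ i, i ∈ σ ↔ v i = 0)
    {K : PreAbstractSimplicialComplex (Fin m)}
    {s : Finset ((Fin n → SignType) ⊕ Finset (Fin m))} (hs : s ∈ (linkModel K σ n).faces) :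
    IsSignChain (insert v (linkVertex e v '' s)) := by
  rintro _ (rfl | ⟨a, ha, rfl⟩) _ (rfl | ⟨b, hb, rfl⟩)
  · exact Or.inl (signLE_refl _)
  · rcases b with y | τ
    · exact Or.inl (signLE_linkVertex_inl e hv y)
    · exact Or.inr (signLE_linkVertex_inr e τ)
  · rcases a with y | τ
    · exact Or.inr (signLE_linkVertex_inl e hv y)
    · exact Or.inl (signLE_linkVertex_inr e τ)
  · rcases a with y | τ <;> rcases b with y' | τ'
    · simp only [signLE_linkVertex_inl_iff]
      exact hs.2.1 y ha y' hb
    · exact Or.inr (signLE_linkVertex_inr_inl e (hs.2.2.2.2 τ' hb).2.1 y)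
    · exact Or.inl (signLE_linkVertex_inr_inl e (hs.2.2.2.2 τ ha).2.1 y')
    · exact (hs.2.2.2.1.total hb ha).imp (signLE_linkVertex_inr_of_subset e)
        (signLE_linkVertex_inr_of_subset e)

theorem linkVertex_injOn (hv : ∀ i, i ∈ σ ↔ v i = 0) (K : PreAbstractSimplicialComplex (Fin m)) :
    InjOn (linkVertex e v) (linkModel K σ n).vertexSet := by
  intro a ha b hb h
  have hne : ∀ (y : Fin n → SignType) (τ : Finset (Fin m)),
      {Sum.inl y} ∈ (linkModel K σ n).faces → {Sum.inr τ} ∈ (linkModel K σ n).faces →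
      linkVertex e v (.inl y) ≠ linkVertex e v (.inr τ) := by
    intro y τ hy hτ h
    refine hy.2.2.1 y (by simp) (funext fun j => ?_)
    have hj := (hτ.2.2.2.2 τ (by simp)).2.1 (e j).2
    have := linkVertex_inl_apply e (v := v) y j
    rw [h] at this
    simpa [linkVertex, hj] using this.symm
  rcases a with y | τ <;> rcases b with y' | τ'
  · congr 1
    ext j
    rw [← linkVertex_inl_apply e (v := v) y j, h, linkVertex_inl_apply]
  · exact absurd h (hne y τ' ha hb)
  · exact absurd h.symm (hne y' τ hb ha)
  · rw [← signZeros_linkVertex_inr e hv (ha.2.2.2.2 τ (by simp)).2.1, h,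
      signZeros_linkVertex_inr e hv (hb.2.2.2.2 τ' (by simp)).2.1]

/-- The link of a vertex with zero set `σ` in the triangulation of the real moment-angle complex is
isomorphic to `linkModel K σ |σ|`. -/
theorem mem_vertexLink_iff (K : PreAbstractSimplicialComplex (Fin m)) (hσ : σ = ∅ ∨ σ ∈ K.faces)
    (hv : ∀ i, i ∈ σ ↔ v i = 0) (t : Finset (Fin m → ℝ)) :
    t ∈ ((momentAngleTriangulation K).vertexLink (signVec v)).faces ↔
      ∃ s ∈ (linkModel K σ n).faces,
        (t : Set (Fin m → ℝ)) = (fun a => signVec (linkVertex e v a)) '' s := by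
  classical
  constructor
  · rintro ⟨ht, hvt, hins'⟩
    have hins : insert (signVec v) t ∈ (signedComplex K).faces := by
      convert hins'
      rfl
    obtain ⟨s₀, ⟨-, hch, hK⟩, hts⟩ := (mem_signedComplex_iff K _).1 hins
    rw [Finset.coe_insert] at hts
    have hvs : v ∈ s₀ := by
      have : signVec v ∈ signVec '' (s₀ : Set (Fin m → SignType)) := hts ▸ mem_insert _ _
      exact (signVec_injective.mem_set_image).1 this
    -- `linkVertex` is not injective on all of its domain, so the two conditions on `a` are needed.
    let s : Finset ((Fin n → SignType) ⊕ Finset (Fin m)) := Finset.univ.filter fun a =>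
      linkVertex e v a ∈ s₀ ∧ (∀ y, a = .inl y → y ≠ 0) ∧
        ∀ τ, a = .inr τ → τ ∈ K.faces ∧ σ ⊂ τ
    have hmem : ∀ a, a ∈ s ↔ linkVertex e v a ∈ s₀ ∧ (∀ y, a = .inl y → y ≠ 0) ∧
        ∀ τ, a = .inr τ → τ ∈ K.faces ∧ σ ⊂ τ := fun a => by simp [s]
    have himg : (t : Set (Fin m → ℝ)) = (fun a => signVec (linkVertex e v a)) '' s := by
      ext z
      constructor
      · intro hz
        obtain ⟨x, hx, rfl⟩ : z ∈ signVec '' (s₀ : Set (Fin m → SignType)) :=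
          hts ▸ mem_insert_of_mem _ hz
        have hxv : x ≠ v := by
          rintro rfl
          exact hvt hz
        rcases hch v hvs x hx with h | h
        · obtain ⟨y, hy, rfl⟩ := exists_eq_linkVertex_inl e hv h hxv
          exact ⟨.inl y, (hmem _).2 ⟨hx, by simpa using hy, by simp⟩, rfl⟩
        · obtain ⟨h1, h2⟩ := exists_eq_linkVertex_inr e hv h hxv
          refine ⟨.inr (signZeros x), (hmem _).2 ⟨h2.symm ▸ hx, by simp, ?_⟩, congrArg signVec h2⟩
          rintro _ ⟨rfl⟩
          exact ⟨(hK x hx).resolve_left fun h0 => by simp [h0] at h1, h1⟩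
      · rintro ⟨a, ha, rfl⟩
        have ha' := (hmem a).1 ha
        have : signVec (linkVertex e v a) ∈ insert (signVec v) (t : Set (Fin m → ℝ)) :=
          hts ▸ mem_image_of_mem _ ha'.1
        refine this.resolve_left fun h => ?_
        have hface : {a} ∈ (linkModel K σ n).faces := by
          refine ⟨by simp, ?_, fun y hy => ha'.2.1 y (Finset.mem_singleton.1 hy).symm, ?_,
            fun τ hτ => ha'.2.2 τ (Finset.mem_singleton.1 hτ).symm⟩
          · intro x hx y hy
            obtain rfl : x = y := by
              simpa using (Finset.mem_singleton.1 hx).trans (Finset.mem_singleton.1 hy).symm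
            exact Or.inl (signLE_refl _)
          · intro x hx y hy hxy
            exact absurd (by
              simpa using (Finset.mem_singleton.1 hx).trans (Finset.mem_singleton.1 hy).symm) hxy
        exact linkVertex_ne e hv hface (Finset.mem_singleton_self a) (signVec_injective h)
    refine ⟨s, ⟨?_, ?_, fun y hy => ((hmem _).1 hy).2.1 y rfl, ?_,
      fun τ hτ => ((hmem _).1 hτ).2.2 τ rfl⟩, himg⟩
    · have : (t : Set (Fin m → ℝ)).Nonempty := Geometry.SimplicialComplex.nonempty_of_mem_faces ht
      rw [himg] at this
      exact Finset.coe_nonempty.1 this.of_image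
    · intro y hy y' hy'
      have := hch _ ((hmem _).1 hy).1 _ ((hmem _).1 hy').1
      simpa only [signLE_linkVertex_inl_iff] using this
    · intro τ hτ τ' hτ' _
      have h := (hmem _).1 hτ
      have h' := (hmem _).1 hτ'
      have := (hch _ h.1 _ h'.1).imp SignLE.signZeros_subset SignLE.signZeros_subset
      rw [signZeros_linkVertex_inr e hv (h.2.2 τ rfl).2.1,
        signZeros_linkVertex_inr e hv (h'.2.2 τ' rfl).2.1] at this
      exact this.symm
  · rintro ⟨s, hs, hts⟩
    have hins : insert (signVec v) t ∈ (momentAngleTriangulation K).faces := by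
      refine (mem_signedComplex_iff K _).2 ⟨insert v (s.image (linkVertex e v)),
        ⟨Finset.insert_nonempty _ _, ?_, ?_⟩, ?_⟩
      · rw [Finset.coe_insert, Finset.coe_image]
        exact isSignChain_linkVertex e hv hs
      · have hsub : ∀ x, SignLE v x → signZeros x = ∅ ∨ signZeros x ∈ K.faces := by
          intro x hx
          have hxσ : signZeros x ⊆ σ := fun i hi => by
            have := hx.signZeros_subset hi
            rw [mem_signZeros] at this
            exact (hv i).2 this
          rcases (signZeros x).eq_empty_or_nonempty with h | h
          · exact Or.inl h
          · rcases hσ with rfl | hσ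
            · exact Or.inl (Finset.subset_empty.1 hxσ)
            · exact Or.inr ((K.isRelLowerSet_faces hσ).2 hxσ h)
        intro x hx
        rcases Finset.mem_insert.1 hx with rfl | hx
        · exact hsub _ (signLE_refl _)
        · obtain ⟨a, ha, rfl⟩ := Finset.mem_image.1 hx
          rcases a with y | τ
          · exact hsub _ (signLE_linkVertex_inl e hv y)
          · rw [signZeros_linkVertex_inr e hv (hs.2.2.2.2 τ ha).2.1]
            exact Or.inr (hs.2.2.2.2 τ ha).1
      · rw [Finset.coe_insert, hts, Finset.coe_insert, Finset.coe_image, image_insert_eq,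
          image_image]
    refine ⟨(momentAngleTriangulation K).down_closed hins (Finset.subset_insert _ _) ?_, ?_, ?_⟩
    · rw [← Finset.coe_nonempty, hts]
      exact (Finset.coe_nonempty.2 hs.1).image _
    · intro hvt
      have : signVec v ∈ (t : Set (Fin m → ℝ)) := hvt
      rw [hts] at this
      obtain ⟨a, ha, h⟩ := this
      exact linkVertex_ne e hv hs ha (signVec_injective h)
    · convert hins

theorem injOn_linkVertex (K : PreAbstractSimplicialComplex (Fin m)) (hσ : σ = ∅ ∨ σ ∈ K.faces)
    (hv : ∀ i, i ∈ σ ↔ v i = 0) :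
    InjOn (Fintype.linearCombination ℝ fun a => signVec (linkVertex e v a))
      (linkModel K σ n).realization :=
  injOn_linearCombination ((momentAngleTriangulation K).vertexLink (signVec v)) _ _
    (signVec_injective.comp_injOn (linkVertex_injOn e hv K)) fun s hs => by
      classical
      exact ⟨s.image fun a => signVec (linkVertex e v a),
        (mem_vertexLink_iff e K hσ hv _).2 ⟨s, hs, Finset.coe_image⟩, Finset.coe_image⟩

theorem space_vertexLink (K : PreAbstractSimplicialComplex (Fin m)) (hσ : σ = ∅ ∨ σ ∈ K.faces)
    (hv : ∀ i, i ∈ σ ↔ v i = 0) :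
    ((momentAngleTriangulation K).vertexLink (signVec v)).space =
      Fintype.linearCombination ℝ (fun a => signVec (linkVertex e v a)) ''
        (linkModel K σ n).realization := by
  rw [← space_linearRealization _ _ (injOn_linkVertex e K hσ hv)]
  congr 1
  refine Geometry.SimplicialComplex.ext ?_
  ext t
  exact mem_vertexLink_iff e K hσ hv t

end Link

/-! ### The model as an iterated join with `S⁰` -/

section CrossPolytope

variable {m n : ℕ}

/-- The number of nonzero entries of a sign vector, as a real number: the `ℓ¹` norm of
`signVec y`. -/
def signWeight (y : Fin n → SignType) : ℝ := ∑ j, |signVec y j|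

theorem signWeight_zero : signWeight (0 : Fin n → SignType) = 0 := by
  simp [signWeight, signVec_zero]

theorem one_le_signWeight {y : Fin n → SignType} (hy : y ≠ 0) : 1 ≤ signWeight y := by
  obtain ⟨j, hj⟩ := Function.ne_iff.1 hy
  have : |signVec y j| = 1 := by
    simp only [signVec]
    simp only [Pi.zero_apply] at hj
    generalize y j = a at *
    cases a
    · exact absurd rfl hj
    · simp
    · simp
  rw [← this]
  exact Finset.single_le_sum (f := fun j => |signVec y j|) (fun _ _ => abs_nonneg _)
    (Finset.mem_univ j)

theorem signWeight_nonneg (y : Fin n → SignType) : 0 ≤ signWeight y :=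
  Finset.sum_nonneg fun _ _ => abs_nonneg _

/-- The placement of the vertices of `linkModel` in `ℝ^n × ℝ^V`, where `V` is the set of subsets of
`Fin m`: a nonzero sign vector goes to the barycentre of the corresponding face of the
cross-polytope, a simplex to the corresponding unit vector. -/
def joinVertex : (Fin n → SignType) ⊕ Finset (Fin m) → (Fin n → ℝ) × (Finset (Fin m) → ℝ)
  | .inl y => ((signWeight y)⁻¹ • signVec y, 0)
  | .inr τ => (0, Pi.single τ 1)

theorem linearCombination_joinVertex (w : (Fin n → SignType) ⊕ Finset (Fin m) → ℝ) :
    Fintype.linearCombination ℝ joinVertex w =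
      (Fintype.linearCombination ℝ signVec fun y => w (.inl y) * (signWeight y)⁻¹,
        fun τ => w (.inr τ)) := by
  simp only [Fintype.linearCombination_apply, Fintype.sum_sum_type, joinVertex]
  refine Prod.ext ?_ ?_
  · simp [Prod.fst_sum, smul_smul]
  · ext τ
    simp [Prod.snd_sum, Finset.sum_apply, Pi.single_apply]

/-- Weights `w` on the barycentres of the faces of the cross-polytope, rescaled to weights on the
centres of the faces of the cube that represent the same point. The rescaling lowers the total
weight, and the difference is given to the centre `0` of the cube. The term at `y = 0` of the
rescaled sum vanishes, as `signWeight 0 = 0`. -/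
def cubeWeights (w : (Fin n → SignType) → ℝ) (y : Fin n → SignType) : ℝ :=
  w y * (signWeight y)⁻¹ + if y = 0 then 1 - ∑ z, w z * (signWeight z)⁻¹ else 0

theorem cubeWeights_mem_realization {w : (Fin n → SignType) → ℝ} (hw : ∀ y, 0 ≤ w y)
    (hsum : ∑ y, w y ≤ 1) {s : Set (Fin n → SignType)} (hs : IsSignChain s)
    (h0 : ∀ y ∉ s, w y = 0) :
    cubeWeights w ∈ (signChainComplex (⊤ : PreAbstractSimplicialComplex (Fin n))).realization := by
  classical
  have hle : ∀ y, 0 ≤ w y * (signWeight y)⁻¹ ∧ w y * (signWeight y)⁻¹ ≤ w y := by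
    intro y
    refine ⟨mul_nonneg (hw y) (inv_nonneg.2 (signWeight_nonneg y)), ?_⟩
    by_cases hy : y = 0
    · simpa [hy, signWeight_zero] using hw 0
    · exact mul_le_of_le_one_right (hw y) (inv_le_one_of_one_le₀ (one_le_signWeight hy))
  have hS : ∑ z, w z * (signWeight z)⁻¹ ≤ 1 :=
    (Finset.sum_le_sum fun y _ => (hle y).2).trans hsum
  refine (mem_realization_iff _ _).2 ⟨⟨fun y => ?_, ?_⟩,
    Finset.univ.filter fun y => y ∈ insert 0 s, ⟨⟨0, by simp⟩, ?_, ?_⟩, ?_⟩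
  · refine add_nonneg (hle y).1 ?_
    split_ifs
    · linarith
    · exact le_rfl
  · simp [cubeWeights, Finset.sum_add_distrib]
  · intro x hx y hy
    simp only [Finset.coe_filter, Finset.mem_univ, true_and, mem_ofPred_eq] at hx hy
    rcases hx with rfl | hx
    · exact Or.inl fun i hi => absurd rfl hi
    · rcases hy with rfl | hy
      · exact Or.inr fun i hi => absurd rfl hi
      · exact hs x hx y hy
  · exact fun x _ => Finset.eq_empty_or_nonempty _
  · intro y hy
    simp only [Finset.mem_filter, Finset.mem_univ, true_and, mem_insert_iff, not_or] at hy
    simp [cubeWeights, hy.1, h0 y hy.2]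

theorem linearCombination_cubeWeights (w : (Fin n → SignType) → ℝ) :
    Fintype.linearCombination ℝ signVec (cubeWeights w) =
      Fintype.linearCombination ℝ signVec fun y => w y * (signWeight y)⁻¹ := by
  simp only [Fintype.linearCombination_apply, cubeWeights]
  refine Finset.sum_congr rfl fun y _ => ?_
  by_cases hy : y = 0
  · simp [hy, signVec_zero]
  · simp [hy]

/-- The second coordinate determines the weights on the simplices; the first one determines the
weights on the sign vectors, by uniqueness of barycentric coordinates in the triangulated cube. -/
theorem injOn_joinVertex (K : PreAbstractSimplicialComplex (Fin m)) (σ : Finset (Fin m)) :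
    InjOn (Fintype.linearCombination ℝ (joinVertex (n := n))) (linkModel K σ n).realization := by
  have hcube : ∀ w ∈ (linkModel K σ n).realization, (cubeWeights fun y => w (.inl y)) ∈
      (signChainComplex (⊤ : PreAbstractSimplicialComplex (Fin n))).realization ∧
      w (.inl 0) = 0 := by
    intro w hw
    obtain ⟨⟨w0, w1⟩, s, hs, h0⟩ := (mem_realization_iff _ w).1 hw
    refine ⟨cubeWeights_mem_realization (fun y => w0 _) ?_ hs.2.1 fun y hy => h0 _ hy,
      h0 _ fun h => hs.2.2.1 0 h rfl⟩
    rw [Fintype.sum_sum_type] at w1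
    have : 0 ≤ ∑ τ, w (.inr τ) := Finset.sum_nonneg fun τ _ => w0 _
    linarith
  intro w hw w' hw' h
  rw [linearCombination_joinVertex, linearCombination_joinVertex, Prod.mk.injEq] at h
  obtain ⟨h1, h2⟩ := h
  rw [← linearCombination_cubeWeights, ← linearCombination_cubeWeights] at h1
  have hu := injOn_signChainComplex _ (hcube w hw).1 (hcube w' hw').1 h1
  ext a
  rcases a with y | τ
  · by_cases hy : y = 0
    · rw [hy, (hcube w hw).2, (hcube w' hw').2]
    · have := congrFun hu y
      simp only [cubeWeights, hy, if_false, add_zero] at this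
      exact mul_right_cancel₀ (inv_ne_zero (by linarith [one_le_signWeight hy])) this
  · exact congrFun h2 τ

/-- The `ℓ¹` norm of a nonnegative combination of a chain of sign vectors. -/
theorem sum_abs_linearCombination_signVec {s : Set (Fin n → SignType)} (hs : IsSignChain s)
    (u : (Fin n → SignType) → ℝ) (hu : ∀ y, 0 ≤ u y) (h0 : ∀ y ∉ s, u y = 0) :
    ∑ j, |Fintype.linearCombination ℝ signVec u j| = ∑ y, u y * signWeight y := by
  have : ∀ j, |Fintype.linearCombination ℝ signVec u j| = ∑ y, u y * |signVec y j| := by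
    intro j
    rw [← abs_linearCombination_signVec hs u hu h0 j, Fintype.linearCombination_apply,
      Finset.sum_apply]
    rfl
  simp only [this, signWeight, Finset.mul_sum]
  exact Finset.sum_comm

/-- A point of the join has a first coordinate in the cube; the weights that represent it there
become, after rescaling, the weights on the sign vectors. -/
theorem image_joinVertex (K L : PreAbstractSimplicialComplex _) (σ : Finset (Fin m))
    (hL : ∀ t : Finset (Finset (Fin m)), t ∈ L.faces ↔
      t.Nonempty ∧ IsChain (· ⊆ ·) (t : Set (Finset (Fin m))) ∧ ∀ τ ∈ t, τ ∈ K.faces ∧ σ ⊂ τ) :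
    Fintype.linearCombination ℝ (joinVertex (n := n)) '' (linkModel K σ n).realization =
      zeroSpheresJoin n L.realization := by
  classical
  ext p
  rw [mem_zeroSpheresJoin_iff]
  constructor
  · rintro ⟨w, hw, rfl⟩
    obtain ⟨⟨w0, w1⟩, s, hs, h0⟩ := (mem_realization_iff _ w).1 hw
    rw [linearCombination_joinVertex]
    refine ⟨?_, fun τ => w0 _, ?_⟩
    · have hy : ∀ y : Fin n → SignType,
          w (.inl y) * (signWeight y)⁻¹ * signWeight y = w (.inl y) := by
        intro y
        by_cases hy : y = 0
        · rw [hy, h0 (.inl 0) fun h => hs.2.2.1 0 h rfl]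
          simp
        · rw [inv_mul_cancel_right₀ (by linarith [one_le_signWeight hy])]
      rw [taxicab, sum_abs_linearCombination_signVec hs.2.1 _
        (fun y => mul_nonneg (w0 _) (inv_nonneg.2 (signWeight_nonneg y)))
        (fun y hy => by rw [h0 _ hy, zero_mul]), Finset.sum_congr rfl fun y _ => hy y, ← w1,
        Fintype.sum_sum_type]
      simp only [abs_of_nonneg (w0 _)]
    · let t : Finset (Finset (Fin m)) := Finset.univ.filter fun τ => Sum.inr τ ∈ s
      have ht : ∀ τ, τ ∈ t ↔ Sum.inr τ ∈ s := fun τ => by simp [t]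
      rcases t.eq_empty_or_nonempty with h | h
      · exact Or.inl (funext fun τ => h0 _ fun h' => by simpa [h] using (ht τ).2 h')
      · refine Or.inr ⟨t, (hL t).2 ⟨h, hs.2.2.2.1.mono fun τ hτ => (ht τ).1 hτ, fun τ hτ =>
          hs.2.2.2.2 τ ((ht τ).1 hτ)⟩, fun τ hτ => h0 _ fun h' => hτ ((ht τ).2 h')⟩
  · rintro ⟨hp, hp0, hcone⟩
    have hz : ∑ τ, |p.2 τ| = ∑ τ, p.2 τ := Finset.sum_congr rfl fun τ _ => abs_of_nonneg (hp0 τ)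
    obtain ⟨u, hu, hup⟩ := exists_signVec_combination p.1 fun j => by
      rw [← hp, taxicab, hz]
      have h1 : |p.1 j| ≤ ∑ j, |p.1 j| :=
        Finset.single_le_sum (f := fun j => |p.1 j|) (fun _ _ => abs_nonneg _) (Finset.mem_univ j)
      have h2 : 0 ≤ ∑ τ, p.2 τ := Finset.sum_nonneg fun τ _ => hp0 τ
      linarith
    obtain ⟨⟨u0, -⟩, s, ⟨-, hs, -⟩, hus⟩ := (mem_realization_iff _ u).1 hu
    obtain ⟨t, ht, ht0⟩ : ∃ t : Finset (Finset (Fin m)), (IsChain (· ⊆ ·)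
        (t : Set (Finset (Fin m))) ∧ ∀ τ ∈ t, τ ∈ K.faces ∧ σ ⊂ τ) ∧ ∀ τ ∉ t, p.2 τ = 0 := by
      rcases hcone with h | ⟨t, ht, h⟩
      · exact ⟨∅, by simp, by simp [h]⟩
      · exact ⟨t, ((hL t).1 ht).2, h⟩
    let w : (Fin n → SignType) ⊕ Finset (Fin m) → ℝ :=
      Sum.elim (fun y => u y * signWeight y) p.2
    have w1 : ∑ a, w a = 1 := by
      rw [Fintype.sum_sum_type, ← hp, taxicab, hz, ← hup,
        sum_abs_linearCombination_signVec hs u u0 hus]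
      rfl
    refine ⟨w, (mem_realization_iff _ w).2
      ⟨⟨?_, w1⟩, (s.erase 0).disjSum t, ⟨?_, ?_, ?_, ?_, ?_⟩, ?_⟩, ?_⟩
    · rintro (y | τ)
      · exact mul_nonneg (u0 y) (signWeight_nonneg y)
      · exact hp0 τ
    · by_contra hne
      rw [Finset.not_nonempty_iff_eq_empty, Finset.disjSum_eq_empty] at hne
      have hw : ∀ a, w a = 0 := by
        rintro (y | τ)
        · by_cases hy : y = 0
          · simp [w, hy, signWeight_zero]
          · simp [w, hus y fun h => by simpa [hne.1] using Finset.mem_erase.2 ⟨hy, h⟩]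
        · exact ht0 τ (by simp [hne.2])
      simp [hw] at w1
    · intro x hx y hy
      simp only [Finset.inl_mem_disjSum, Finset.mem_erase, mem_ofPred_eq] at hx hy
      exact hs x hx.2 y hy.2
    · intro y hy
      exact (Finset.mem_erase.1 (Finset.inl_mem_disjSum.1 hy)).1
    · simpa using ht.1
    · intro τ hτ
      exact ht.2 τ (Finset.inr_mem_disjSum.1 hτ)
    · rintro (y | τ) ha
      · by_cases hy : y = 0
        · simp [w, hy, signWeight_zero]
        · have : y ∉ s := fun h => ha (Finset.inl_mem_disjSum.2 (Finset.mem_erase.2 ⟨hy, h⟩))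
          simp [w, hus y this]
      · exact ht0 τ fun h => ha (Finset.inr_mem_disjSum.2 h)
    · rw [linearCombination_joinVertex]
      refine Prod.ext ?_ rfl
      rw [← hup]
      simp only [Fintype.linearCombination_apply]
      refine Finset.sum_congr rfl fun y _ => ?_
      by_cases hy : y = 0
      · simp [hy, signVec_zero]
      · simp only [w, Sum.elim_inl]
        rw [mul_inv_cancel_right₀ (by linarith [one_le_signWeight hy])]

end CrossPolytope

/-! ### Full flags and their links -/

section Flags

variable {m : ℕ}

/-- Every finite set `σ` carries a chain of `|σ|` nonempty subsets, one of which is `σ`. -/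
theorem exists_full_flag {α : Type*} (σ : Finset α) : ∃ c : Finset (Finset α), c.card = σ.card ∧
    IsChain (· ⊆ ·) (c : Set (Finset α)) ∧ (∀ τ ∈ c, τ.Nonempty ∧ τ ⊆ σ) ∧
    (σ.Nonempty → σ ∈ c) := by
  classical
  induction σ using Finset.induction_on with
  | empty => exact ⟨∅, by simp, by simp, by simp, by simp⟩
  | insert a s ha ih =>
    obtain ⟨c, hcard, hc, hsub, -⟩ := ih
    refine ⟨insert (insert a s) c, ?_, ?_, ?_, fun _ => Finset.mem_insert_self _ _⟩
    · rw [Finset.card_insert_of_notMem, Finset.card_insert_of_notMem ha, hcard]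
      exact fun h => ha ((hsub _ h).2 (Finset.mem_insert_self a s))
    · rw [Finset.coe_insert]
      exact hc.insert fun τ hτ _ => Or.inr ((hsub τ hτ).2.trans (Finset.subset_insert a s))
    · intro τ hτ
      rcases Finset.mem_insert.1 hτ with rfl | h
      · exact ⟨Finset.insert_nonempty _ _, subset_rfl⟩
      · exact ⟨(hsub τ h).1, (hsub τ h).2.trans (Finset.subset_insert a s)⟩

/-- A chain of nonempty subsets of `σ` has at most `|σ|` members, as they have different
cardinalities between `1` and `|σ|`. -/
theorem card_chain_le {α : Type*} (σ : Finset α) (c : Finset (Finset α))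
    (hc : IsChain (· ⊆ ·) (c : Set (Finset α))) (h : ∀ τ ∈ c, τ.Nonempty ∧ τ ⊆ σ) :
    c.card ≤ σ.card := by
  have himg : c.image Finset.card ⊆ Finset.Icc 1 σ.card := by
    intro k hk
    obtain ⟨τ, hτ, rfl⟩ := Finset.mem_image.1 hk
    exact Finset.mem_Icc.2 ⟨(h τ hτ).1.card_pos, Finset.card_le_card (h τ hτ).2⟩
  have hinj : InjOn Finset.card (c : Set (Finset α)) := by
    intro τ hτ τ' hτ' hcard
    rcases hc.total hτ hτ' with h' | h'
    · exact Finset.eq_of_subset_of_card_le h' hcard.ge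
    · exact (Finset.eq_of_subset_of_card_le h' hcard.le).symm
  simpa [Finset.card_image_of_injOn hinj] using Finset.card_le_card himg

/-- The link in `K'` of a full flag ending in `σ` consists of the chains of simplices properly
containing `σ`. -/
theorem mem_simplexLink_full_flag_iff (K : PreAbstractSimplicialComplex (Fin m))
    {σ : Finset (Fin m)} {c : Finset (Finset (Fin m))} (hc : c ∈ (derivedComplex K).faces)
    (hcard : c.card = σ.card) (hσc : σ ∈ c) (hsub : ∀ τ ∈ c, τ ⊆ σ)
    (t : Finset (Finset (Fin m))) : t ∈ ((derivedComplex K).simplexLink c).faces ↔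
      t.Nonempty ∧ IsChain (· ⊆ ·) (t : Set (Finset (Fin m))) ∧ ∀ τ ∈ t, τ ∈ K.faces ∧ σ ⊂ τ := by
  classical
  constructor
  · rintro ⟨ht, hdisj, hunion⟩
    refine ⟨ht.1, ht.2.1, fun τ hτ => ⟨ht.2.2 τ hτ, ?_⟩⟩
    have hτc : τ ∉ c := Finset.disjoint_left.1 hdisj hτ
    have hτσ : ¬ τ ⊆ σ := by
      intro hle
      have hins : insert τ c ⊆ t ∪ c :=
        Finset.insert_subset (Finset.mem_union_left _ hτ) Finset.subset_union_right
      have := card_chain_le σ (insert τ c)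
        (hunion.2.1.mono (by convert Finset.coe_subset.2 hins)) fun ρ hρ => by
          rcases Finset.mem_insert.1 hρ with rfl | h
          · exact ⟨(K.isRelLowerSet_faces (ht.2.2 ρ hτ)).1, hle⟩
          · exact ⟨(K.isRelLowerSet_faces (hc.2.2 ρ h)).1, hsub ρ h⟩
      rw [Finset.card_insert_of_notMem hτc] at this
      omega
    have hcomp := hunion.2.1.total (x := σ) (y := τ) (by simp [hσc]) (by simp [hτ])
    exact ⟨hcomp.resolve_right hτσ, hτσ⟩
  · rintro ⟨hne, ht, hK⟩
    have hunion : t ∪ c ∈ (derivedComplex K).faces := by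
      refine ⟨?_, ?_, ?_⟩
      · exact hne.mono Finset.subset_union_left
      · intro τ hτ ρ hρ hne
        rcases Finset.mem_union.1 hτ with h | h <;> rcases Finset.mem_union.1 hρ with h' | h'
        · exact ht h h' hne
        · exact Or.inr ((hsub ρ h').trans (hK τ h).2.1)
        · exact Or.inl ((hsub τ h).trans (hK ρ h').2.1)
        · exact hc.2.1 h h' hne
      · intro τ hτ
        rcases Finset.mem_union.1 hτ with h | h
        · exact (hK τ h).1
        · exact hc.2.2 τ h
    exact ⟨⟨hne, ht, fun τ hτ => (hK τ hτ).1⟩,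
      Finset.disjoint_left.2 fun τ hτ hτc => (hK τ hτ).2.2 (hsub τ hτc), by convert hunion⟩

end Flags

/-! ### Vertices and their links -/

section VertexLinks

variable {m : ℕ}

theorem exists_signVec_of_mem_vertices (K : PreAbstractSimplicialComplex (Fin m)) {v : Fin m → ℝ}
    (hv : v ∈ (momentAngleTriangulation K).vertices) :
    ∃ x : Fin m → SignType, signVec x = v ∧ (signZeros x = ∅ ∨ signZeros x ∈ K.faces) := by
  obtain ⟨s, hs, h⟩ := (mem_signedComplex_iff K {v}).1 hv
  obtain ⟨x, hx, rfl⟩ : v ∈ signVec '' (s : Set (Fin m → SignType)) := h ▸ by simp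
  exact ⟨x, rfl, hs.2.2 x hx⟩

theorem simpliciallyIsomorphic_vertexLink (K : PreAbstractSimplicialComplex (Fin m))
    {x : Fin m → SignType} (hx : ∀ i, x i ≠ 0) :
    SimpliciallyIsomorphic (derivedComplex K)
      ((momentAngleTriangulation K).vertexLink (signVec x)).toPreAbstractSimplicialComplex := by
  classical
  let e : Fin 0 ≃ {i // i ∈ (∅ : Finset (Fin m))} := Equiv.equivOfIsEmpty _ _
  have hv : ∀ i, i ∈ (∅ : Finset (Fin m)) ↔ x i = 0 := fun i => by simp [hx i]
  have hmem := mem_vertexLink_iff e K (Or.inl rfl) hv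
  have hface : ∀ c, c ∈ (derivedComplex K).faces ↔ c.image Sum.inr ∈ (linkModel K ∅ 0).faces := by
    intro c
    constructor
    · intro hc
      refine ⟨hc.1.image _, ?_, ?_, ?_, ?_⟩
      · intro y hy; simp at hy
      · intro y hy; simp at hy
      · simpa using hc.2.1
      · intro τ hτ
        have hK := hc.2.2 τ (by simpa using hτ)
        exact ⟨hK, Finset.empty_ssubset.2 (K.isRelLowerSet_faces hK).1⟩
    · intro hc
      refine ⟨by simpa using hc.1, by simpa using hc.2.2.2.1, fun τ hτ => ?_⟩
      exact (hc.2.2.2.2 τ (by simpa using hτ)).1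
  refine ⟨fun τ => signVec (linkVertex e x (.inr τ)), ?_, ?_⟩
  · intro τ _ τ' _ h
    have h' := congrArg signZeros (signVec_injective h)
    rwa [signZeros_linkVertex_inr e hv (Finset.empty_subset _),
      signZeros_linkVertex_inr e hv (Finset.empty_subset _)] at h'
  · refine PreAbstractSimplicialComplex.ext ?_
    ext t
    rw [hmem]
    constructor
    · rintro ⟨c, hc, rfl⟩
      refine ⟨_, (hface c).1 hc, ?_⟩
      simp [image_image]
    · rintro ⟨s, hs, hts⟩
      -- For `n = 0` there are no nonzero sign vectors, so `s` consists of simplices only.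
      have hsr : (Finset.univ.filter fun τ => Sum.inr τ ∈ s).image Sum.inr = s := by
        ext a
        rcases a with y | τ
        · simpa using fun h => hs.2.2.1 y h (Subsingleton.elim _ _)
        · simp
      refine ⟨_, (hface _).2 (hsr.symm ▸ hs), Finset.coe_injective ?_⟩
      rw [hts]
      conv_rhs => rw [← hsr]
      simp [image_image]

end VertexLinks

end

theorem mainTheorem6 (m : ℕ) (K : PreAbstractSimplicialComplex (Fin m)) (v : Fin m → ℝ)
    (hv : v ∈ (momentAngleTriangulation K).vertices) :
    ((∀ i, v i ≠ 0) ∧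
      SimpliciallyIsomorphic (derivedComplex K)
        ((momentAngleTriangulation K).vertexLink v).toPreAbstractSimplicialComplex) ∨
    ∃ (k : ℕ) (σ : Finset (Fin m)), σ ∈ K.faces ∧ σ.card = k + 1 ∧ (∀ i, i ∈ σ ↔ v i = 0) ∧
      (∃ σ' ∈ (derivedComplex K).faces, σ'.card = k + 1 ∧ σ ∈ σ' ∧ ∀ τ ∈ σ', τ ⊆ σ) ∧
      ∀ σ' ∈ (derivedComplex K).faces, σ'.card = k + 1 → σ ∈ σ' → (∀ τ ∈ σ', τ ⊆ σ) →
        PLHomeomorphic ((momentAngleTriangulation K).vertexLink v).space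
          (zeroSpheresJoin (k + 1) ((derivedComplex K).simplexLink σ').realization) := by
  obtain ⟨x, rfl, hxK⟩ := exists_signVec_of_mem_vertices K hv
  have hzero : ∀ i, signVec x i = 0 ↔ x i = 0 := fun i => by
    simp only [signVec]
    cases x i <;> norm_num
  rcases hxK with h0 | hσ
  · have hx : ∀ i, x i ≠ 0 := fun i hi => by simpa [h0] using mem_signZeros.2 hi
    exact Or.inl ⟨fun i => (hzero i).not.2 (hx i), simpliciallyIsomorphic_vertexLink K hx⟩
  · have hne : (signZeros x).Nonempty := (K.isRelLowerSet_faces hσ).1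
    obtain ⟨k, hk⟩ := Nat.exists_eq_succ_of_ne_zero hne.card_pos.ne'
    refine Or.inr ⟨k, signZeros x, hσ, hk, fun i => by rw [hzero, mem_signZeros], ?_, ?_⟩
    · obtain ⟨c, hcard, hc, hsub, hmem⟩ := exists_full_flag (signZeros x)
      exact ⟨c, ⟨⟨_, hmem hne⟩, hc, fun τ hτ => (K.isRelLowerSet_faces hσ).2 (hsub τ hτ).2
        (hsub τ hτ).1⟩, hcard.trans hk, hmem hne, fun τ hτ => (hsub τ hτ).2⟩
    · intro c hc hcard hσc hsub
      let e : Fin (k + 1) ≃ {i // i ∈ signZeros x} := (Finset.equivFinOfCardEq hk).symm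
      rw [space_vertexLink e K (Or.inr hσ) fun i => mem_signZeros, ← image_joinVertex K _ _
        (mem_simplexLink_full_flag_iff K hc (hcard.trans hk.symm) hσc hsub)]
      exact plHomeomorphic_image _ _ _ (injOn_linkVertex e K (Or.inr hσ) fun i => mem_signZeros)
        (injOn_joinVertex K _)
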